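/- Let $\mathcal X$ be a Polish space, and let $(\Omega,\mathcal F,(\mathcal F_t)_{t\ge0},X_t,P^x)$, $x\in\mathcal X$, be a time-homogeneous $\mathcal X$-valued càdlàg Markov family with transition probability kernels $p_t(x,dy)$. That is: $X_t$ is $\mathcal F_t$-adapted with càdlàg paths; each $P^x$ is a probability measure on $(\Omega,\mathcal F)$ with $X_0\sim\delta_x$ under $P^x$; $x\mapsto P^x(F)$ is universally measurable for every $F\in\mathcal F$; and $P^x(X_{t+s}\in B\mid\mathcal F_s)=p_t(X_s,B)$ $P^x$-a.s. for all $x\in\mathcal X$, $s,t\ge0$ and Borel sets $B$. Let $\widetilde P^x$, $x\in\mathcal X$, be a second family of probability measures on $(\Omega,\mathcal F)$ such that $X_0\sim\delta_x$ under $\widetilde P^x$ and $x\mapsto\widetilde P^x(F)$ is universally measurable for every $F\in\mathcal F$ (the process $X$ need not be Markov under $\widetilde P^x$). Let $\mu^*$ be an invariant probability measure for $(p_t)$, let $\widetilde\mu$ be any probability measure on $\mathcal X$, and let $P^{\mu^*}=\int P^x\,\mu^*(dx)$, $\widetilde P^{\widetilde\mu}=\int\widetilde P^x\,\widetilde\mu(dx)$,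 with restrictions $P^{\mu^*}_T$, $\widetilde P^{\widetilde\mu}_T$ to $\mathcal F_T$. Write $\mu^*[f]=\int f\,d\mu^*$. Let $(A,D(A,\mathbb R))$ be the generator of the semigroup $\mathcal P_t[g](x)=\int g(y)\,p_t(x,dy)$ on real $L^2(\mu^*)$ (it need not be self-adjoint), and suppose that it satisfies the Poincaré inequality with constant $\alpha>0$: $$\operatorname{Var}_{\mu^*}(g)\le-\alpha\langle A[g],g\rangle_{L^2(\mu^*)}\qquad\text{for all } g\in D(A,\mathbb R).$$ For bounded measurable $V:\mathcal X\to\mathbb R$ put $$\kappa(V)=\sup\Big\{\langle A[g],g\rangle+\int V|g|^2\,d\mu^*: g\in D(A,\mathbb R),\ \|g\|_{L^2(\mu^*)}=1\Big\}.$$ Let $f:\mathcal X\to\mathbb R$ be bounded and measurable, let $T>0$, and set $$V_{\pm c}=\pm c\,(f-\mu^*[f]),\quad \eta=\tfrac1T R\big(\widetilde P^{\widetilde\mu}_T\,\big\|\,P^{\mu^*}_T\big)\in[0,\infty],\quad \sigma^2=2\alpha\operatorname{Var}_{\mu^*}[f],\quad M^\pm=\alpha\big\|(f-\mu^*[f])^\pm\big\|_{L^\infty(\mu^*)},$$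 where $R$ denotes relative entropy. Then, for each choice of the sign $\pm$, $$\pm\left(\widetilde E^{\widetilde\mu}\left[\frac1T\int_0^Tf(X_t)\,dt\right]-\mu^*[f]\right)\ \le\ \inf_{c>0}\frac{\kappa(V_{\pm c})+\eta}{c},$$ and, if $\eta<\infty$, $$\inf_{c>0}\frac{\kappa(V_{\pm c})+\eta}{c}\ \le\ \sqrt{2\sigma^2\eta}+M^\pm\eta .$$ In particular, if $\eta<\infty$, then $\pm\big(\widetilde E^{\widetilde\mu}[\frac1T\int_0^Tf(X_t)dt]-\mu^*[f]\big)\le\sqrt{2\sigma^2\eta}+M^\pm\eta$. -/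

import Mathlib

open MeasureTheory ProbabilityTheory Filter Topology Set
open scoped NNReal ENNReal

namespace MarkovUQ

/-- A function on a measurable space is universally measurable if it is measurable with respect to
the completion of the σ-algebra under every probability measure. -/
def UniversallyMeasurable {𝓧 : Type*} [MeasurableSpace 𝓧] (φ : 𝓧 → ℝ≥0∞) : Prop :=
  ∀ μ : Measure 𝓧, IsProbabilityMeasure μ → NullMeasurable φ μ

/-- A càdlàg path: right-continuous with left limits. -/
def IsCadlagPath {𝓧 : Type*} [TopologicalSpace 𝓧] (x : ℝ≥0 → 𝓧) : Prop :=
  ∀ t, ContinuousWithinAt x (Ici t) t ∧ ∃ l, Tendsto x (𝓝[<] t) (𝓝 l)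

/-- A family of probability measures `Q^x`, `x ∈ 𝓧`, under which the process `X` starts at `x`,
and which depends on `x` in a universally measurable way. -/
structure IsInitialFamily {Ω 𝓧 : Type*} [MeasurableSpace Ω] [MeasurableSpace 𝓧]
    (X : ℝ≥0 → Ω → 𝓧) (Q : 𝓧 → Measure Ω) : Prop where
  isProb : ∀ x, IsProbabilityMeasure (Q x)
  map_zero : ∀ x, (Q x).map (X 0) = Measure.dirac x
  univMeas : ∀ F, MeasurableSet F → UniversallyMeasurable (fun x => Q x F)

/-- A time-homogeneous càdlàg Markov family `(Ω, ℱ, ℱ_t, X_t, P^x)` with transition probability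
kernels `p_t`. -/
structure IsMarkovFamily {Ω 𝓧 : Type*} [mΩ : MeasurableSpace Ω] [MeasurableSpace 𝓧]
    [TopologicalSpace 𝓧] (ℱ : Filtration ℝ≥0 mΩ) (X : ℝ≥0 → Ω → 𝓧) (p : ℝ≥0 → Kernel 𝓧 𝓧)
    (P : 𝓧 → Measure Ω) : Prop extends IsInitialFamily X P where
  adapted : ∀ t, Measurable[ℱ t] (X t)
  cadlag : ∀ ω, IsCadlagPath (fun t => X t ω)
  isMarkovKernel : ∀ t, IsMarkovKernel (p t)
  markov : ∀ (x : 𝓧) (s t : ℝ≥0) (B : Set 𝓧), MeasurableSet B →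
    (P x)[(X (t + s) ⁻¹' B).indicator (fun _ => (1 : ℝ)) | ℱ s]
      =ᵐ[P x] fun ω => (p t (X s ω)).real B

/-- The mixture `Q^μ(F) = ∫ Q^x(F) μ(dx)`. -/
noncomputable def mixture {Ω 𝓧 : Type*} [MeasurableSpace Ω] [MeasurableSpace 𝓧]
    (μ : Measure 𝓧) [hμ : IsProbabilityMeasure μ] (Q : 𝓧 → Measure Ω)
    (hQ : ∀ F, MeasurableSet F → UniversallyMeasurable (fun x => Q x F)) : Measure Ω :=
  Measure.ofMeasurable (fun F _ => ∫⁻ x, Q x F ∂μ) (by simp) (by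
    intro F hF hd
    rw [← lintegral_tsum (fun i => (hQ (F i) (hF i) μ hμ).aemeasurable)]
    exact lintegral_congr fun x => measure_iUnion hd hF)

/-- The relative entropy `R(Q_T ‖ P_T)` of the restrictions of two measures to `ℱ_T`. -/
noncomputable def relEntropyUpTo {Ω : Type*} [mΩ : MeasurableSpace Ω] (ℱ : Filtration ℝ≥0 mΩ)
    (T : ℝ≥0) (Q P : Measure Ω) : ℝ≥0∞ :=
  InformationTheory.klDiv (Q.trim (ℱ.le T)) (P.trim (ℱ.le T))

/-- The action of a transition kernel on functions, `𝓟_t[g](x) = ∫ g(y) p_t(x,dy)`. -/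
noncomputable def semigroupAct {𝓧 : Type*} [MeasurableSpace 𝓧] (p : ℝ≥0 → Kernel 𝓧 𝓧) (t : ℝ≥0)
    (g : 𝓧 → ℝ) (x : 𝓧) : ℝ :=
  ∫ y, g y ∂(p t x)

/-- `IsGenerator p μ g h` says that `g` lies in the real domain `D(A,ℝ)` of the generator `A` of
the semigroup `𝓟_t` on `L²(μ)`, with `A[g] = h`: the difference quotients `(𝓟_t g - g)/t` tend to
`h` in `L²(μ)` as `t ↓ 0`. It is used for measures `μ` invariant under all `p_t`, in which case the
choice of the representative of `g` does not matter. -/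
def IsGenerator {𝓧 : Type*} [MeasurableSpace 𝓧] (p : ℝ≥0 → Kernel 𝓧 𝓧) (μ : Measure 𝓧)
    (g h : Lp ℝ 2 μ) : Prop :=
  Tendsto (fun t : ℝ≥0 => eLpNorm (fun x => (t : ℝ)⁻¹ * (semigroupAct p t g x - g x) - h x) 2 μ)
    (𝓝[>] 0) (𝓝 0)

/-- The Poincaré inequality `Var_μ(g) ≤ -α ⟨A[g], g⟩` for all `g ∈ D(A,ℝ)`. -/
def PoincareInequality {𝓧 : Type*} [MeasurableSpace 𝓧] (p : ℝ≥0 → Kernel 𝓧 𝓧) (μ : Measure 𝓧)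
    (α : ℝ) : Prop :=
  ∀ g h : Lp ℝ 2 μ, IsGenerator p μ g h → Var[g; μ] ≤ -α * inner ℝ h g

/-- `κ(V) = sup {⟨A[g], g⟩ + ∫ V |g|² dμ : g ∈ D(A,ℝ), ‖g‖_{L²(μ)} = 1}`. -/
noncomputable def kappa {𝓧 : Type*} [MeasurableSpace 𝓧] (p : ℝ≥0 → Kernel 𝓧 𝓧) (μ : Measure 𝓧)
    (V : 𝓧 → ℝ) : EReal :=
  sSup {r : EReal | ∃ g h : Lp ℝ 2 μ, IsGenerator p μ g h ∧ ‖g‖ = 1 ∧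
    r = ((inner ℝ h g + ∫ x, V x * (g x) ^ 2 ∂μ : ℝ) : EReal)}

/-- `Ξ^±(Λ, η) = inf_{c > 0} (Λ(± c) + η) / c`, where `s = ± 1` is the sign. -/
noncomputable def Xi (s : ℝ) (Λ : ℝ → EReal) (η : ℝ≥0∞) : EReal :=
  ⨅ (c : ℝ) (_ : 0 < c), (Λ (s * c) + (η : EReal)) / (c : EReal)

/-- The bias `E_Q[(1/T) ∫_0^T f(X_t) dt] - ∫ f dμ`. -/
noncomputable def bias {Ω 𝓧 : Type*} [MeasurableSpace Ω] [MeasurableSpace 𝓧] (X : ℝ≥0 → Ω → 𝓧)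
    (Q : Measure Ω) (μ : Measure 𝓧) (f : 𝓧 → ℝ) (T : ℝ≥0) : ℝ :=
  (∫ ω, (T : ℝ)⁻¹ * (∫ t in (0 : ℝ)..(T : ℝ), f (X t.toNNReal ω)) ∂Q) - ∫ x, f x ∂μ

/-- `M^± = α ‖(f - μ[f])^±‖_∞`, with the essential supremum norm of `L^∞(μ)`, where `s = ± 1` is
the sign. -/
noncomputable def bernsteinM {𝓧 : Type*} [MeasurableSpace 𝓧] (s α : ℝ) (μ : Measure 𝓧)
    (f : 𝓧 → ℝ) : ℝ :=
  α * (eLpNorm (fun x => max (s * (f x - ∫ y, f y ∂μ)) 0) ∞ μ).toReal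

end MarkovUQ

/-!
The time average of `V = c s (f - μ[f])` under `Q` is compared with the stationary Markov process
`P` by the Donsker–Varadhan inequality
`E_Q[∫_0^T V(X_t) dt] ≤ R(Q_T ‖ P_T) + log E_P[exp (∫_0^T V(X_t) dt)]`
(`integral_le_relEntropyUpTo_add_log`), and the exponential moment is bounded by the Feynman–Kac
estimate `E_P[exp (∫_0^T V(X_t) dt)] ≤ e^{T κ(V)}`
(`IsStationaryMarkov.integral_exp_primitive_le`).

The Feynman–Kac estimate is proved without constructing the semigroup generated by `A + V`, whose
domain would have to be understood for merely measurable `V`. The path is sampled at the partial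
sums `τ_1 < τ_2 < ...` of independent exponential times of mean `h = T / n`. By the Markov property
`E_P[exp (h ∑_{k ≤ n} V(X_{τ_k}))] = ⟨1, ((1 - hA)⁻¹ e^{hV})^n 1⟩` in `L²(μ)`
(`IsStationaryMarkov.integral_mul_sampledExp`), because the transition semigroup averaged over an
exponential time is the resolvent of its generator. The resolvent maps into the domain of `A`, and
`w = (1 - hA)⁻¹ g` satisfies `‖g‖² ≥ ‖w‖² - 2h ⟨A w, w⟩`; hence
`‖e^{hV} w‖² ≤ ‖w‖² + 2h ⟨V w, w⟩ + O(h²) ‖w‖² ≤ (1 + 2h κ(V) + O(h²)) ‖g‖²`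
(`IsStationaryMarkov.norm_expMul_resolvent_sq_le`), uniformly in `g`, and the `n`-fold product is at
most `e^{T κ(V) + O(h)}`.

Conversely, for a fixed path the conditional mean of `h ∑_{k ≤ n} V(X_{τ_k})` given the path is
exactly that of `∫_0^{τ_n} V(X_t) dt` (`integral_primitive_add`), which differs from
`∫_0^T V(X_t) dt` by at most `C E|τ_n - T| = O(n^{-1/2})`. Jensen's inequality therefore bounds
`exp (∫_0^T V(X_t) dt)` by the mean exponential of the sampled sum
(`exp_primitive_le_sampledExp`), and `n → ∞` gives the estimate.

Under the Poincaré inequality, writing `g = ⟨g, 1⟩ + g^⊥` in the supremum that defines `κ` and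
absorbing the cross term in the spectral gap gives `κ(cW) ≤ α c² Var(f) / (1 - cM)` for
`W = s (f - μ[f])` (`kappa_const_mul_le`); the infimum over `c` is then elementary
(`Xi_le_sqrt_add`).
-/

namespace MarkovUQ

section

/-! ### The exponential law -/

/-- The standard exponential law, as a measure on `ℝ`. -/
noncomputable def stdExpLaw : Measure ℝ :=
  (volume.restrict (Ioi 0)).withDensity fun y => ENNReal.ofReal (Real.exp (-y))

/-- The law on `ℝ≥0` of an exponentially distributed time of mean `h`. -/
noncomputable def expLaw (h : ℝ≥0) : Measure ℝ≥0 :=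
  stdExpLaw.map fun y => h * y.toNNReal

lemma integrableOn_exp_neg_Ioi_zero : IntegrableOn (fun y : ℝ => Real.exp (-y)) (Ioi 0) := by
  simpa using exp_neg_integrableOn_Ioi 0 one_pos

instance : IsProbabilityMeasure stdExpLaw := by
  constructor
  rw [stdExpLaw, withDensity_apply _ MeasurableSet.univ, Measure.restrict_univ,
    ← ofReal_integral_eq_lintegral_ofReal integrableOn_exp_neg_Ioi_zero
      (Eventually.of_forall fun _ => (Real.exp_pos _).le), integral_exp_neg_Ioi_zero,
    ENNReal.ofReal_one]

lemma measurable_mul_toNNReal (h : ℝ≥0) : Measurable fun y : ℝ => h * y.toNNReal := by fun_prop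

instance (h : ℝ≥0) : IsProbabilityMeasure (expLaw h) :=
  Measure.isProbabilityMeasure_map (measurable_mul_toNNReal h).aemeasurable

section Integral

variable {E : Type*} [NormedAddCommGroup E] [NormedSpace ℝ E]

lemma integral_stdExpLaw (F : ℝ → E) :
    ∫ y, F y ∂stdExpLaw = ∫ y in Ioi (0 : ℝ), Real.exp (-y) • F y := by
  rw [stdExpLaw, integral_withDensity_eq_integral_toReal_smul (by fun_prop)
    (Eventually.of_forall fun _ => ENNReal.ofReal_lt_top)]
  simp_rw [ENNReal.toReal_ofReal (Real.exp_pos _).le]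

lemma integrable_stdExpLaw_iff (F : ℝ → E) :
    Integrable F stdExpLaw ↔ IntegrableOn (fun y => Real.exp (-y) • F y) (Ioi 0) := by
  rw [stdExpLaw, integrable_withDensity_iff_integrable_smul' (by fun_prop)
    (Eventually.of_forall fun _ => ENNReal.ofReal_lt_top)]
  simp_rw [ENNReal.toReal_ofReal (Real.exp_pos _).le]
  rfl

lemma integral_expLaw (h : ℝ≥0) {F : ℝ≥0 → E} (hF : StronglyMeasurable F) :
    ∫ y, F y ∂expLaw h = ∫ y in Ioi (0 : ℝ), Real.exp (-y) • F (h * y.toNNReal) := by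
  rw [expLaw, integral_map (measurable_mul_toNNReal h).aemeasurable hF.aestronglyMeasurable,
    integral_stdExpLaw]

lemma integrable_expLaw_iff (h : ℝ≥0) {F : ℝ≥0 → E} (hF : StronglyMeasurable F) :
    Integrable F (expLaw h) ↔
      IntegrableOn (fun y : ℝ => Real.exp (-y) • F (h * y.toNNReal)) (Ioi 0) := by
  rw [expLaw, integrable_map_measure hF.aestronglyMeasurable
    (measurable_mul_toNNReal h).aemeasurable, ← integrable_stdExpLaw_iff]
  rfl

lemma integral_Ioi_comp_add_right (F : ℝ → E) (a : ℝ) :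
    ∫ y in Ioi (0 : ℝ), F (y + a) = ∫ y in Ioi a, F y := by
  have := (measurePreserving_add_right (volume : Measure ℝ) a).setIntegral_preimage_emb
    (measurableEmbedding_addRight a) F (Ioi a)
  rw [← this]
  congr 2
  ext y
  simp

end Integral

lemma integrable_coe_expLaw (h : ℝ≥0) : Integrable (fun y : ℝ≥0 => (y : ℝ)) (expLaw h) := by
  rw [integrable_expLaw_iff h (by fun_prop)]
  have := (Real.GammaIntegral_convergent (s := 2) (by norm_num)).const_mul (h : ℝ)
  refine IntegrableOn.congr_fun this (fun y hy => ?_) measurableSet_Ioi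
  have hy' : (0 : ℝ) ≤ y := le_of_lt hy
  norm_num [Real.coe_toNNReal y hy']
  ring

lemma integral_coe_expLaw (h : ℝ≥0) : ∫ y, (y : ℝ) ∂expLaw h = h := by
  rw [integral_expLaw h (by fun_prop)]
  have := Real.Gamma_eq_integral (s := 2) (by norm_num)
  rw [Real.Gamma_two] at this
  rw [← mul_one (h : ℝ), this, ← integral_const_mul]
  refine setIntegral_congr_fun measurableSet_Ioi fun y hy => ?_
  have hy' : (0 : ℝ) ≤ y := le_of_lt hy
  norm_num [Real.coe_toNNReal y hy']
  ring

lemma integrable_coe_sq_expLaw (h : ℝ≥0) :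
    Integrable (fun y : ℝ≥0 => (y : ℝ) ^ 2) (expLaw h) := by
  rw [integrable_expLaw_iff h (by fun_prop)]
  have := (Real.GammaIntegral_convergent (s := 3) (by norm_num)).const_mul ((h : ℝ) ^ 2)
  refine IntegrableOn.congr_fun this (fun y hy => ?_) measurableSet_Ioi
  have hy' : (0 : ℝ) ≤ y := le_of_lt hy
  have h2 : y ^ ((3 : ℝ) - 1) = y ^ 2 := by rw [← Real.rpow_natCast]; norm_num
  simp only [h2, NNReal.coe_mul, Real.coe_toNNReal y hy', smul_eq_mul]
  ring

lemma integral_coe_sq_expLaw (h : ℝ≥0) : ∫ y, (y : ℝ) ^ 2 ∂expLaw h = 2 * (h : ℝ) ^ 2 := by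
  rw [integral_expLaw h (by fun_prop)]
  have := Real.Gamma_eq_integral (s := 3) (by norm_num)
  have h3 : Real.Gamma 3 = 2 := by
    have := Real.Gamma_nat_eq_factorial 2
    rw [show ((2 : ℕ) : ℝ) + 1 = 3 by norm_num] at this
    exact this.trans (by norm_num [Nat.factorial])
  rw [h3] at this
  rw [this, mul_comm, ← integral_const_mul]
  refine setIntegral_congr_fun measurableSet_Ioi fun y hy => ?_
  have hy' : (0 : ℝ) ≤ y := le_of_lt hy
  have h2 : y ^ ((3 : ℝ) - 1) = y ^ 2 := by rw [← Real.rpow_natCast]; norm_num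
  simp only [h2, NNReal.coe_mul, Real.coe_toNNReal y hy', smul_eq_mul]
  ring

/-- Integration by parts against the density `e^{-y}`, by Fubini's theorem: for `g` merely
measurable the primitive need not be differentiable everywhere. -/
lemma integral_exp_neg_mul_primitive {g : ℝ → ℝ} (hg : Measurable g) {C : ℝ}
    (hC : ∀ y, |g y| ≤ C) :
    ∫ y in Ioi (0 : ℝ), Real.exp (-y) * ∫ u in (0 : ℝ)..y, g u
      = ∫ u in Ioi (0 : ℝ), Real.exp (-u) * g u := by
  have hC0 : 0 ≤ C := (abs_nonneg _).trans (hC 0)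
  set K : ℝ → ℝ → ℝ := fun y u => if u ≤ y then Real.exp (-y) * g u else 0 with hK
  have hKm : Measurable (Function.uncurry K) := by
    refine Measurable.ite (measurableSet_le measurable_snd measurable_fst) ?_ measurable_const
    fun_prop
  have hin : ∀ y, y ∈ Ioi (0 : ℝ) →
      (∫ u in Ioi (0 : ℝ), K y u) = Real.exp (-y) * ∫ u in (0 : ℝ)..y, g u := by
    intro y hy
    rw [intervalIntegral.integral_of_le (le_of_lt hy), ← integral_const_mul,
      ← Ioi_inter_Iic, ← setIntegral_indicator measurableSet_Iic]
    rfl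
  have hint : Integrable (Function.uncurry K)
      ((volume.restrict (Ioi (0 : ℝ))).prod (volume.restrict (Ioi (0 : ℝ)))) := by
    rw [integrable_prod_iff hKm.aestronglyMeasurable]
    have hb : ∀ y, y ∈ Ioi (0 : ℝ) → IntegrableOn (fun u => K y u) (Ioi 0) ∧
        ∫ u in Ioi (0 : ℝ), ‖K y u‖ ≤ C * (Real.exp (-y) * y) := by
      intro y hy
      have hdom : IntegrableOn ((Iic y).indicator fun _ : ℝ => Real.exp (-y) * C) (Ioi 0) := by
        rw [IntegrableOn, integrable_indicator_iff measurableSet_Iic, IntegrableOn,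
          Measure.restrict_restrict measurableSet_Iic, Iic_inter_Ioi]
        exact integrableOn_const measure_Ioc_lt_top.ne
      have hle : ∀ u, ‖K y u‖ ≤ (Iic y).indicator (fun _ : ℝ => Real.exp (-y) * C) u := by
        intro u
        by_cases hu : u ≤ y
        · simp only [hK, hu, if_true, mem_Iic, indicator_of_mem, norm_mul, Real.norm_eq_abs,
            Real.abs_exp]
          exact mul_le_mul_of_nonneg_left (hC u) (Real.exp_pos _).le
        · simp [hK, hu]
      have hi : IntegrableOn (fun u => K y u) (Ioi 0) :=
        hdom.mono' (hKm.comp measurable_prodMk_left).aestronglyMeasurable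
          (Eventually.of_forall hle)
      refine ⟨hi, (integral_mono hi.norm hdom hle).trans (le_of_eq ?_)⟩
      rw [setIntegral_indicator measurableSet_Iic, Ioi_inter_Iic, setIntegral_const]
      simp [le_of_lt (show (0 : ℝ) < y from hy)]
      ring
    refine ⟨(ae_restrict_mem measurableSet_Ioi).mono fun y hy => (hb y hy).1, ?_⟩
    have hG := (Real.GammaIntegral_convergent (s := 2) (by norm_num)).const_mul C
    refine Integrable.mono' hG ?_ ?_
    · exact (hKm.stronglyMeasurable.norm.integral_prod_right').aestronglyMeasurable
    · filter_upwards [ae_restrict_mem measurableSet_Ioi] with y hy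
      rw [Real.norm_of_nonneg (integral_nonneg fun _ => norm_nonneg _)]
      refine ((hb y hy).2).trans (le_of_eq ?_)
      norm_num
  rw [← setIntegral_congr_fun measurableSet_Ioi hin, integral_integral_swap hint]
  refine setIntegral_congr_fun measurableSet_Ioi fun u hu => ?_
  have h1 : (fun y => K y u) = (Ici u).indicator fun y => Real.exp (-y) * g u := by
    ext y; rfl
  have hsub : Ioi (0 : ℝ) ∩ Ici u = Ici u := by
    rw [inter_eq_right]; exact fun y hy => lt_of_lt_of_le (show (0 : ℝ) < u from hu) hy
  simp only [h1]
  rw [setIntegral_indicator measurableSet_Ici, hsub, integral_mul_const,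
    integral_Ici_eq_integral_Ioi, integral_exp_neg_Ioi]

/-! ### Contraction semigroups and their resolvents -/

variable {E : Type*} [NormedAddCommGroup E] [NormedSpace ℝ E]

/-- A strongly continuous one-parameter semigroup of linear contractions. -/
structure IsContractionSemigroup (U : ℝ≥0 → E →L[ℝ] E) : Prop where
  zero : ∀ g, U 0 g = g
  add : ∀ s t g, U (s + t) g = U s (U t g)
  norm_le : ∀ t g, ‖U t g‖ ≤ ‖g‖
  continuous : ∀ g, Continuous fun t => U t g

/-- The resolvent `(1 - hA)⁻¹` of the generator `A` of the semigroup, written as the average of the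
semigroup over an exponentially distributed time of mean `h`. -/
noncomputable def resolvent (U : ℝ≥0 → E →L[ℝ] E) (h : ℝ≥0) (g : E) : E :=
  ∫ y, U y g ∂expLaw h

namespace IsContractionSemigroup

variable {U : ℝ≥0 → E →L[ℝ] E} (hU : IsContractionSemigroup U)
include hU

lemma integrable (h : ℝ≥0) (g : E) : Integrable (fun y => U y g) (expLaw h) :=
  Integrable.of_bound (hU.continuous g).stronglyMeasurable.aestronglyMeasurable ‖g‖
    (Eventually.of_forall fun t => hU.norm_le t g)

lemma norm_resolvent_le (h : ℝ≥0) (g : E) : ‖resolvent U h g‖ ≤ ‖g‖ := by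
  refine (norm_integral_le_of_norm_le_const (Eventually.of_forall fun t => hU.norm_le t g)).trans ?_
  simp

/-- The range of the resolvent lies in the domain of the generator, and
`A (1 - hA)⁻¹ g = h⁻¹ ((1 - hA)⁻¹ g - g)`. -/
lemma tendsto_resolvent [CompleteSpace E] {h : ℝ≥0} (hh : 0 < h) (g : E) :
    Tendsto (fun t : ℝ≥0 => (t : ℝ)⁻¹ • (U t (resolvent U h g) - resolvent U h g)) (𝓝[>] 0)
      (𝓝 ((h : ℝ)⁻¹ • (resolvent U h g - g))) := by
  set u : ℝ → E := fun y => Real.exp (-y) • U (h * y.toNNReal) g with hu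
  have hh' : (0 : ℝ) < h := hh
  have huc : Continuous u := by
    have := hU.continuous g
    fun_prop
  have hui : IntegrableOn u (Ioi 0) :=
    (integrable_expLaw_iff h (hU.continuous g).stronglyMeasurable).1 (hU.integrable h g)
  have hR : resolvent U h g = ∫ y in Ioi (0 : ℝ), u y :=
    integral_expLaw h (hU.continuous g).stronglyMeasurable
  set φ : ℝ → E := fun a => Real.exp a • (resolvent U h g - ∫ y in (0 : ℝ)..a, u y) with hφ
  have hφ0 : φ 0 = resolvent U h g := by simp [hφ]
  have hUt : ∀ t : ℝ≥0, U t (resolvent U h g) = φ (t / h) := by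
    intro t
    have h0 : (0 : ℝ) ≤ t / h := by positivity
    have h1 : resolvent U h g - ∫ y in (0 : ℝ)..(t / h), u y = ∫ y in Ioi ((t : ℝ) / h), u y := by
      rw [hR, ← intervalIntegral.integral_Ioi_sub_Ioi hui h0, sub_sub_cancel]
    rw [hφ]
    simp only
    rw [h1, ← integral_Ioi_comp_add_right, ← integral_smul]
    rw [resolvent, ← ContinuousLinearMap.integral_comp_comm _ (hU.integrable h g),
      integral_expLaw h (F := fun y => U t (U y g))
        ((U t).continuous.comp (hU.continuous g)).stronglyMeasurable]
    refine setIntegral_congr_fun measurableSet_Ioi fun y hy => ?_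
    have hy' : (0 : ℝ) ≤ y := le_of_lt hy
    have h2 : t + h * y.toNNReal = h * (y + t / h).toNNReal := by
      apply NNReal.coe_injective
      push_cast
      rw [Real.coe_toNNReal _ hy', Real.coe_toNNReal _ (by positivity)]
      field_simp
      ring
    simp only [hu, ← hU.add, h2, smul_smul, ← Real.exp_add]
    congr 2
    ring
  have hd : HasDerivAt φ (resolvent U h g - g) 0 := by
    have h1 : HasDerivAt (fun a => ∫ y in (0 : ℝ)..a, u y) (u 0) 0 :=
      intervalIntegral.integral_hasDerivAt_right (by simp)
        (huc.stronglyMeasurableAtFilter _ _) huc.continuousAt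
    have h2 := (Real.hasDerivAt_exp 0).smul (h1.const_sub (resolvent U h g))
    convert! h2 using 1
    simp [hu, hU.zero]
    abel
  have ht := hd.tendsto_slope_zero_right
  have hlim : Tendsto (fun t : ℝ≥0 => (t : ℝ) / h) (𝓝[>] 0) (𝓝[>] 0) := by
    refine tendsto_nhdsWithin_iff.2 ⟨?_, ?_⟩
    · have : Continuous fun t : ℝ≥0 => (t : ℝ) / h := by fun_prop
      simpa using (this.tendsto 0).mono_left nhdsWithin_le_nhds
    · filter_upwards [self_mem_nhdsWithin] with t ht
      have : (0 : ℝ) < t := ht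
      exact div_pos this hh'
  refine ((ht.comp hlim).const_smul ((h : ℝ)⁻¹)).congr' ?_
  filter_upwards [self_mem_nhdsWithin] with t ht
  have ht' : (0 : ℝ) < t := ht
  simp only [Function.comp, zero_add, hφ0, ← hUt, smul_smul]
  congr 1
  field_simp

end IsContractionSemigroup

end

section

/-! ### Sampling a path at exponentially spaced times -/

/-- The expectation of `exp (h ∑_{k ≤ n} ψ (t + τ_k))`, where `τ_k` is the sum of `k` independent
exponential times of mean `h`; it is defined by recursion on the first time `τ_1`. -/
noncomputable def sampledExp (h : ℝ≥0) (ψ : ℝ≥0 → ℝ) : ℕ → ℝ≥0 → ℝ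
  | 0, _ => 1
  | n + 1, t => ∫ y, Real.exp (h * ψ (t + y)) * sampledExp h ψ n (t + y) ∂expLaw h

lemma measurable_sampledExp {Ω : Type*} [MeasurableSpace Ω] (h : ℝ≥0) {ψ : Ω → ℝ≥0 → ℝ}
    (hψ : Measurable (Function.uncurry ψ)) (n : ℕ) :
    Measurable fun q : Ω × ℝ≥0 => sampledExp h (ψ q.1) n q.2 := by
  induction n with
  | zero => exact measurable_const
  | succ n ih =>
    have h1 : Measurable fun q : (Ω × ℝ≥0) × ℝ≥0 =>
        Real.exp (h * ψ q.1.1 (q.1.2 + q.2)) * sampledExp h (ψ q.1.1) n (q.1.2 + q.2) := by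
      have hm : Measurable fun q : (Ω × ℝ≥0) × ℝ≥0 => (q.1.1, q.1.2 + q.2) := by fun_prop
      exact ((hψ.comp hm).const_mul _).exp.mul (ih.comp hm)
    exact h1.stronglyMeasurable.integral_prod_right'.measurable

section Path

variable {h : ℝ≥0} {ψ : ℝ≥0 → ℝ} (hψ : Measurable ψ) {C : ℝ} (hC : ∀ t, |ψ t| ≤ C)

include hψ in
lemma measurable_sampledExp_path (n : ℕ) : Measurable (sampledExp h ψ n) :=
  (measurable_sampledExp (Ω := Unit) (ψ := fun _ => ψ) h (hψ.comp measurable_snd) n).comp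
    (measurable_prodMk_left (x := ()))

lemma sampledExp_nonneg (n : ℕ) (t : ℝ≥0) : 0 ≤ sampledExp h ψ n t := by
  induction n generalizing t with
  | zero => exact zero_le_one
  | succ n ih => exact integral_nonneg fun y => mul_nonneg (Real.exp_pos _).le (ih _)

include hC in
lemma exp_mul_le (t : ℝ≥0) : Real.exp (h * ψ t) ≤ Real.exp (h * C) :=
  Real.exp_le_exp.2 (mul_le_mul_of_nonneg_left ((le_abs_self _).trans (hC t)) h.2)

include hC in
lemma sampledExp_le (n : ℕ) (t : ℝ≥0) : sampledExp h ψ n t ≤ Real.exp (h * C) ^ n := by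
  induction n generalizing t with
  | zero => exact le_of_eq (pow_zero _).symm
  | succ n ih =>
    refine (integral_mono_of_nonneg (Eventually.of_forall fun y =>
      mul_nonneg (Real.exp_pos _).le (sampledExp_nonneg _ _)) (integrable_const _)
      (Eventually.of_forall fun y => ?_)).trans_eq (integral_const (Real.exp (h * C) ^ (n + 1))
        |>.trans (by simp))
    rw [pow_succ']
    exact mul_le_mul (exp_mul_le hC _) (ih _) (sampledExp_nonneg _ _) (Real.exp_pos _).le

include hψ hC

lemma integrable_sampledExp_integrand (n : ℕ) (t : ℝ≥0) :
    Integrable (fun y => Real.exp (h * ψ (t + y)) * sampledExp h ψ n (t + y)) (expLaw h) := by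
  have hm := measurable_sampledExp_path (h := h) hψ n
  refine Integrable.of_bound (C := Real.exp (h * C) ^ (n + 1))
    (Measurable.aestronglyMeasurable (by fun_prop)) (Eventually.of_forall fun y => ?_)
  rw [Real.norm_of_nonneg (mul_nonneg (Real.exp_pos _).le (sampledExp_nonneg _ _)), pow_succ']
  exact mul_le_mul (exp_mul_le hC _) (sampledExp_le hC _ _) (sampledExp_nonneg _ _)
    (Real.exp_pos _).le

omit hψ hC in
/-- The primitive `∫_0^t ψ` of a path. -/
noncomputable def primitive (ψ : ℝ≥0 → ℝ) (t : ℝ≥0) : ℝ :=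
  ∫ u in (0 : ℝ)..t, ψ u.toNNReal

lemma intervalIntegrable_path (a b : ℝ) :
    IntervalIntegrable (fun u : ℝ => ψ u.toNNReal) volume a b := by
  rw [intervalIntegrable_iff]
  exact Measure.integrableOn_of_bounded (M := C) (by simp)
    (hψ.comp measurable_real_toNNReal).aestronglyMeasurable
    (Eventually.of_forall fun u => hC _)

lemma abs_primitive_sub_le (s t : ℝ≥0) :
    |primitive ψ t - primitive ψ s| ≤ C * |(t : ℝ) - s| := by
  rw [primitive, primitive, intervalIntegral.integral_interval_sub_left
    (intervalIntegrable_path hψ hC _ _) (intervalIntegrable_path hψ hC _ _)]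
  have := intervalIntegral.norm_integral_le_of_norm_le_const (a := (s : ℝ)) (b := t)
    (f := fun u : ℝ => ψ u.toNNReal) (C := C) fun u _ => hC _
  exact this

omit hψ in
lemma abs_primitive_le (T : ℝ≥0) : |primitive ψ T| ≤ C * T := by
  have := intervalIntegral.norm_integral_le_of_norm_le_const (a := (0 : ℝ)) (b := T)
    (f := fun u : ℝ => ψ u.toNNReal) (C := C) fun u _ => hC _
  rwa [sub_zero, abs_of_nonneg (NNReal.coe_nonneg T)] at this

lemma continuous_primitive : Continuous (primitive ψ) := by
  have : LipschitzWith C.toNNReal (primitive ψ) := by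
    refine LipschitzWith.of_dist_le_mul fun s t => ?_
    rw [Real.coe_toNNReal C ((abs_nonneg _).trans (hC 0))]
    exact abs_primitive_sub_le hψ hC t s
  exact this.continuous

lemma integrable_primitive_add (t : ℝ≥0) :
    Integrable (fun y => primitive ψ (t + y)) (expLaw h) := by
  have hc := continuous_primitive hψ hC
  refine Integrable.mono' (g := fun y : ℝ≥0 => C * (t + y))
    (((integrable_const _).add (integrable_coe_expLaw h)).const_mul C)
    (Continuous.aestronglyMeasurable (by fun_prop)) (Eventually.of_forall fun y => ?_)
  have := abs_primitive_sub_le hψ hC 0 (t + y)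
  have h0 : primitive ψ 0 = 0 := by simp [primitive]
  rw [h0, sub_zero, NNReal.coe_zero, sub_zero, abs_of_nonneg (NNReal.coe_nonneg _),
    NNReal.coe_add] at this
  exact this

lemma integrable_path_add (t : ℝ≥0) : Integrable (fun y => ψ (t + y)) (expLaw h) :=
  Integrable.of_bound (Measurable.aestronglyMeasurable (by fun_prop)) C
    (Eventually.of_forall fun y => hC _)

/-- The mean of the integral of `ψ` over a time interval of exponentially distributed length is `h`
times the mean of `ψ` at the end of that interval. -/
lemma integral_primitive_add (t : ℝ≥0) :
    ∫ y, primitive ψ (t + y) ∂expLaw h = primitive ψ t + h * ∫ y, ψ (t + y) ∂expLaw h := by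
  have hc := continuous_primitive hψ hC
  have hg : Measurable fun u : ℝ => ψ (h * u + t).toNNReal := by fun_prop
  have hkey := integral_exp_neg_mul_primitive hg (fun y => hC _)
  have h1 : ∀ y ∈ Ioi (0 : ℝ), Real.exp (-y) • (primitive ψ (t + h * y.toNNReal) - primitive ψ t)
      = h * (Real.exp (-y) * ∫ u in (0 : ℝ)..y, ψ (h * u + t).toNNReal) := by
    intro y hy
    have hy' : (0 : ℝ) ≤ y := le_of_lt hy
    rw [primitive, primitive, intervalIntegral.integral_interval_sub_left
      (intervalIntegrable_path hψ hC _ _) (intervalIntegrable_path hψ hC _ _)]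
    have := intervalIntegral.smul_integral_comp_mul_add (a := 0) (b := y)
      (fun u : ℝ => ψ u.toNNReal) (h : ℝ) (t : ℝ)
    rw [smul_eq_mul] at this
    rw [mul_left_comm, this, smul_eq_mul]
    push_cast
    rw [Real.coe_toNNReal _ hy', mul_zero, zero_add, add_comm (t : ℝ)]
  have h2 : ∫ y, (primitive ψ (t + y) - primitive ψ t) ∂expLaw h
      = h * ∫ y, ψ (t + y) ∂expLaw h := by
    rw [integral_expLaw h (Continuous.stronglyMeasurable (by fun_prop)),
      integral_expLaw h (Measurable.stronglyMeasurable (by fun_prop)),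
      setIntegral_congr_fun measurableSet_Ioi h1, integral_const_mul, hkey]
    congr 1
    refine setIntegral_congr_fun measurableSet_Ioi fun y hy => ?_
    have hy' : (0 : ℝ) ≤ y := le_of_lt hy
    have h3 : (h * y + t : ℝ).toNNReal = t + h * y.toNNReal := by
      apply NNReal.coe_injective
      push_cast
      rw [Real.coe_toNNReal _ hy', Real.coe_toNNReal _ (by positivity), add_comm]
    simp only [h3, smul_eq_mul]
  rw [integral_sub (integrable_primitive_add hψ hC t) (integrable_const _)] at h2
  simp only [integral_const, probReal_univ, one_smul] at h2
  linarith

omit hψ hC in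
/-- A bound for `E |primitive ψ (t + τ_n) - primitive ψ T|` when `|ψ| ≤ C`, from
`|x| ≤ δ / 2 + x ^ 2 / (2 δ)` and the mean `n h` and variance `n h ^ 2` of `τ_n`. -/
noncomputable def samplingError (h T : ℝ≥0) (C δ : ℝ) (n : ℕ) (t : ℝ≥0) : ℝ :=
  C * (δ / 2 + ((t + n * h - T) ^ 2 + n * h ^ 2 : ℝ) / (2 * δ))

omit hψ hC in
lemma samplingError_add_eq (T : ℝ≥0) (δ : ℝ) (n : ℕ) (t y : ℝ≥0) :
    samplingError h T C δ n (t + y) =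
      C * (δ / 2 + ((t + n * h - T) ^ 2 + n * h ^ 2 : ℝ) / (2 * δ))
        + C * (2 * (t + n * h - T)) / (2 * δ) * y + C / (2 * δ) * (y : ℝ) ^ 2 := by
  simp only [samplingError, NNReal.coe_add]
  ring

omit hψ hC in
lemma integrable_samplingError_add (T : ℝ≥0) (δ : ℝ) (n : ℕ) (t : ℝ≥0) :
    Integrable (fun y => samplingError h T C δ n (t + y)) (expLaw h) := by
  simp_rw [samplingError_add_eq]
  exact ((integrable_const _).add ((integrable_coe_expLaw h).const_mul _)).add
    ((integrable_coe_sq_expLaw h).const_mul _)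

omit hψ hC in
lemma integral_samplingError_add (T : ℝ≥0) (δ : ℝ) (n : ℕ) (t : ℝ≥0) :
    ∫ y, samplingError h T C δ n (t + y) ∂expLaw h = samplingError h T C δ (n + 1) t := by
  simp_rw [samplingError_add_eq]
  have i1 (c : ℝ) : Integrable (fun y : ℝ≥0 => c * (y : ℝ)) (expLaw h) :=
    (integrable_coe_expLaw h).const_mul c
  have i2 (c d : ℝ) : Integrable (fun y : ℝ≥0 => c + d * (y : ℝ)) (expLaw h) :=
    (integrable_const c).add (i1 d)
  rw [integral_add (i2 _ _) ((integrable_coe_sq_expLaw h).const_mul _),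
    integral_add (integrable_const _) (i1 _)]
  simp only [integral_const_mul, integral_coe_expLaw, integral_coe_sq_expLaw, integral_const,
    probReal_univ, one_smul, samplingError]
  push_cast
  ring

/-- Jensen's inequality, applied one sampling time after the other: the exponential of the time
integral of `ψ` is at most the mean exponential of its sampled sum, up to the sampling error. -/
lemma exp_primitive_le_sampledExp (T : ℝ≥0) {δ : ℝ} (hδ : 0 < δ) (n : ℕ) (t : ℝ≥0) :
    Real.exp (primitive ψ T - primitive ψ t - samplingError h T C δ n t)
      ≤ sampledExp h ψ n t := by
  have hC0 : 0 ≤ C := (abs_nonneg _).trans (hC 0)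
  induction n generalizing t with
  | zero =>
    rw [sampledExp, Real.exp_le_one_iff]
    have h1 := (le_abs_self _).trans (abs_primitive_sub_le hψ hC t T)
    have h2 : |(T : ℝ) - t| ≤ δ / 2 + ((t : ℝ) - T) ^ 2 / (2 * δ) := by
      rw [← sub_nonneg]
      have : δ / 2 + ((t : ℝ) - T) ^ 2 / (2 * δ) - |(T : ℝ) - t|
          = (|(T : ℝ) - t| - δ) ^ 2 / (2 * δ) := by
        have h3 : (|(T : ℝ) - t| - δ) ^ 2
            = ((t : ℝ) - T) ^ 2 - 2 * |(T : ℝ) - t| * δ + δ ^ 2 := by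
          rw [sub_sq, sq_abs]
          ring
        rw [h3]
        field_simp
        ring
      rw [this]
      positivity
    have h3 := mul_le_mul_of_nonneg_left h2 hC0
    simp only [samplingError, Nat.cast_zero, zero_mul, add_zero]
    linarith
  | succ n ih =>
    set a : ℝ≥0 → ℝ := fun y => h * ψ (t + y) +
      (primitive ψ T - primitive ψ (t + y) - samplingError h T C δ n (t + y)) with ha
    have i1 := (integrable_path_add (h := h) hψ hC t).const_mul (h : ℝ)
    have i2 := integrable_primitive_add (h := h) hψ hC t
    have i3 := integrable_samplingError_add (h := h) (C := C) T δ n t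
    have i4 : Integrable (fun _ : ℝ≥0 => primitive ψ T) (expLaw h) := integrable_const _
    have i5 : Integrable (fun y => primitive ψ T - primitive ψ (t + y)) (expLaw h) := i4.sub i2
    have i6 : Integrable (fun y => primitive ψ T - primitive ψ (t + y)
        - samplingError h T C δ n (t + y)) (expLaw h) := i5.sub i3
    have hai : Integrable a (expLaw h) := i1.add i6
    have haint : ∫ y, a y ∂expLaw h
        = primitive ψ T - primitive ψ t - samplingError h T C δ (n + 1) t := by
      rw [ha, integral_add i1 i6, integral_sub i5 i3,
        integral_sub i4 i2, integral_const_mul, integral_primitive_add hψ hC,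
        integral_samplingError_add]
      simp only [integral_const, probReal_univ, one_smul]
      ring
    have hle : ∀ y, Real.exp (a y) ≤ Real.exp (h * ψ (t + y)) * sampledExp h ψ n (t + y) := by
      intro y
      rw [ha, Real.exp_add]
      exact mul_le_mul_of_nonneg_left (ih _) (Real.exp_pos _).le
    have hJ := integrable_sampledExp_integrand (h := h) hψ hC n t
    have hexp : Integrable (fun y => Real.exp (a y)) (expLaw h) :=
      hJ.mono' (Real.continuous_exp.comp_aestronglyMeasurable hai.aestronglyMeasurable)
        (Eventually.of_forall fun y => by
          rw [Real.norm_of_nonneg (Real.exp_pos _).le]; exact hle y)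
    rw [← haint]
    exact (convexOn_exp.map_integral_le Real.continuous_exp.continuousOn isClosed_univ
      (by simp) hai hexp).trans (integral_mono hexp hJ hle)

end Path

end

section

/-! ### The `L²` semigroup of a stationary Markov process -/

variable {Ω 𝓧 : Type*} [mΩ : MeasurableSpace Ω] [TopologicalSpace 𝓧] [MeasurableSpace 𝓧]

/-- A right-continuous time-homogeneous Markov process with transition kernels `p` under the single
measure `Pm`, stationary with one-time marginal `μ`. -/
structure IsStationaryMarkov (ℱ : Filtration ℝ≥0 mΩ) (X : ℝ≥0 → Ω → 𝓧) (p : ℝ≥0 → Kernel 𝓧 𝓧)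
    (μ : Measure 𝓧) (Pm : Measure Ω) : Prop where
  isProb : IsProbabilityMeasure Pm
  adapted : ∀ t, Measurable[ℱ t] (X t)
  rightCont : ∀ ω t, ContinuousWithinAt (fun r => X r ω) (Ici t) t
  isMarkovKernel : ∀ t, IsMarkovKernel (p t)
  map_eq : ∀ t, Pm.map (X t) = μ
  markov : ∀ s t F, MeasurableSet[ℱ s] F →
    (Pm.restrict F).map (X (t + s)) = ((Pm.restrict F).map (X s)).bind (p t)

omit [TopologicalSpace 𝓧] in
lemma integral_bind_kernel {m : Measure 𝓧} {κ : Kernel 𝓧 𝓧} {b : 𝓧 → ℝ}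
    (hb : Integrable b (m.bind κ)) : ∫ y, b y ∂m.bind κ = ∫ x, ∫ y, b y ∂κ x ∂m := by
  rw [Measure.comp_eq_comp_const_apply] at hb ⊢
  rw [Kernel.integral_comp hb, Kernel.const_apply]

omit [TopologicalSpace 𝓧] in
lemma integrable_integral_kernel {m : Measure 𝓧} {κ : Kernel 𝓧 𝓧} {b : 𝓧 → ℝ}
    (hb : Integrable b (m.bind κ)) : Integrable (fun x => ∫ y, b y ∂κ x) m := by
  rw [Measure.comp_eq_comp_const_apply] at hb
  simpa using hb.integral_comp

namespace IsStationaryMarkov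

variable {ℱ : Filtration ℝ≥0 mΩ} {X : ℝ≥0 → Ω → 𝓧} {p : ℝ≥0 → Kernel 𝓧 𝓧} {μ : Measure 𝓧}
  {Pm : Measure Ω} (hX : IsStationaryMarkov ℱ X p μ Pm)
include hX

lemma measurable (t : ℝ≥0) : Measurable (X t) := (hX.adapted t).mono (ℱ.le t) le_rfl

lemma measurePreserving (t : ℝ≥0) : MeasurePreserving (X t) Pm μ :=
  ⟨hX.measurable t, hX.map_eq t⟩

lemma setIntegral_comp_eq (t : ℝ≥0) {F : 𝓧 → ℝ} (hF : AEStronglyMeasurable F μ) {B : Set 𝓧}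
    (hB : MeasurableSet B) : ∫ ω in X t ⁻¹' B, F (X t ω) ∂Pm = ∫ x in B, F x ∂μ := by
  rw [← hX.map_eq t] at hF ⊢
  rw [setIntegral_map hB hF (hX.measurable t).aemeasurable]

lemma isProbabilityMeasure : IsProbabilityMeasure μ :=
  have := hX.isProb
  hX.map_eq 0 ▸ Measure.isProbabilityMeasure_map (hX.measurable 0).aemeasurable

lemma integrable_semigroupAct {b : 𝓧 → ℝ} (hbi : Integrable b μ)
    (t : ℝ≥0) : Integrable (semigroupAct p t b) μ := by
  have h := hX.markov 0 t univ MeasurableSet.univ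
  rw [Measure.restrict_univ, hX.map_eq, hX.map_eq] at h
  rw [h] at hbi
  exact integrable_integral_kernel hbi

lemma setIntegral_comp_add {b : 𝓧 → ℝ} (hb : StronglyMeasurable b) (hbi : Integrable b μ)
    (s t : ℝ≥0) {F : Set Ω} (hF : MeasurableSet[ℱ s] F) :
    ∫ ω in F, b (X (t + s) ω) ∂Pm = ∫ ω in F, semigroupAct p t b (X s ω) ∂Pm := by
  have := hX.isMarkovKernel t
  have hbi' : Integrable b ((p t) ∘ₘ ((Pm.restrict F).map (X s))) := by
    rw [← hX.markov s t F hF]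
    refine hbi.mono_measure ?_
    rw [← hX.map_eq (t + s)]
    exact Measure.map_mono Measure.restrict_le_self (hX.measurable _)
  rw [← integral_map (hX.measurable _).aemeasurable hb.aestronglyMeasurable, hX.markov s t F hF,
    integral_bind_kernel hbi', integral_map (hX.measurable _).aemeasurable]
  · rfl
  · exact (hb.integral_kernel (κ := p t)).aestronglyMeasurable

/-- The Markov property, for integrable functions of the future state. -/
lemma condExp_comp_add {b : 𝓧 → ℝ} (hb : StronglyMeasurable b) (hbi : Integrable b μ)
    (s t : ℝ≥0) :
    Pm[fun ω => b (X (t + s) ω) | ℱ s] =ᵐ[Pm] fun ω => semigroupAct p t b (X s ω) := by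
  have := hX.isProb
  refine (ae_eq_condExp_of_forall_setIntegral_eq (ℱ.le s)
    ((hX.measurePreserving _).integrable_comp_of_integrable hbi)
    (fun F _ _ => ((hX.measurePreserving s).integrable_comp_of_integrable
      (hX.integrable_semigroupAct hbi t)).integrableOn)
    (fun F hF _ => (hX.setIntegral_comp_add hb hbi s t hF).symm) ?_).symm
  exact ((hb.integral_kernel (κ := p t)).comp_measurable (hX.adapted s)).aestronglyMeasurable

lemma integral_mul_comp_add_semigroupAct {Z : Ω → ℝ} {s : ℝ≥0} (hZ : StronglyMeasurable[ℱ s] Z)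
    (hZ2 : MemLp Z 2 Pm) (t : ℝ≥0) (b : Lp ℝ 2 μ) :
    ∫ ω, Z ω * b (X (t + s) ω) ∂Pm = ∫ ω, Z ω * semigroupAct p t b (X s ω) ∂Pm := by
  have := hX.isProb
  have := hX.isProbabilityMeasure
  have hbX : MemLp (fun ω => b (X (t + s) ω)) 2 Pm :=
    (Lp.memLp b).comp_measurePreserving (hX.measurePreserving _)
  have hbi := (Lp.memLp b).integrable one_le_two
  have h1 := condExp_mul_of_stronglyMeasurable_left (μ := Pm) hZ (hZ2.integrable_mul hbX)
    (hbX.integrable one_le_two)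
  have h2 := hX.condExp_comp_add (Lp.stronglyMeasurable b) hbi s t
  rw [← integral_condExp (ℱ.le s)]
  refine integral_congr_ae ?_
  filter_upwards [h1, h2] with ω h1 h2
  have h1' : (Pm[fun ω => Z ω * b (X (t + s) ω)|ℱ s]) ω
      = Z ω * (Pm[fun ω => b (X (t + s) ω)|ℱ s]) ω := h1
  rw [h1', h2]

omit hX in
/-- The isometric embedding `g ↦ g ∘ X_t` of `L²(μ)` into `L²(Pm)`. -/
noncomputable def compLp (hX : IsStationaryMarkov ℱ X p μ Pm) (t : ℝ≥0) :
    Lp ℝ 2 μ →ₗᵢ[ℝ] Lp ℝ 2 Pm :=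
  Lp.compMeasurePreservingₗᵢ ℝ (X t) (hX.measurePreserving t)

lemma coeFn_compLp (t : ℝ≥0) (g : Lp ℝ 2 μ) : hX.compLp t g =ᵐ[Pm] fun ω => g (X t ω) :=
  Lp.coeFn_compMeasurePreserving g (hX.measurePreserving t)

omit hX in
/-- The transition semigroup on `L²(μ)`. It is obtained as `ι_0† ι_t`, where `ι_t` is the embedding
`g ↦ g ∘ X_t`, so that boundedness and linearity need no proof. -/
noncomputable def semigroup (hX : IsStationaryMarkov ℱ X p μ Pm) (t : ℝ≥0) :
    Lp ℝ 2 μ →L[ℝ] Lp ℝ 2 μ :=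
  (hX.compLp 0).toContinuousLinearMap.adjoint ∘L (hX.compLp t).toContinuousLinearMap

lemma inner_semigroup (t : ℝ≥0) (a b : Lp ℝ 2 μ) :
    inner ℝ a (hX.semigroup t b) = inner ℝ (hX.compLp 0 a) (hX.compLp t b) := by
  simp [semigroup, ContinuousLinearMap.adjoint_inner_right]

lemma coeFn_semigroup (t : ℝ≥0) (b : Lp ℝ 2 μ) :
    hX.semigroup t b =ᵐ[μ] semigroupAct p t b := by
  have := hX.isProb
  have := hX.isProbabilityMeasure
  have hbi := (Lp.memLp b).integrable one_le_two
  refine Integrable.ae_eq_of_forall_setIntegral_eq _ _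
    ((Lp.memLp _).integrable one_le_two) (hX.integrable_semigroupAct hbi t) fun B hB hB' => ?_
  have hF : MeasurableSet[ℱ 0] (X 0 ⁻¹' B) := hX.adapted 0 hB
  have hF' : MeasurableSet (X 0 ⁻¹' B) := ℱ.le 0 _ hF
  have h1 : hX.compLp 0 (indicatorConstLp 2 hB hB'.ne (1 : ℝ))
      = indicatorConstLp 2 hF' (measure_ne_top Pm _) 1 :=
    Lp.indicatorConstLp_compMeasurePreserving hB hB'.ne 1 (hX.measurePreserving 0)
  have h3 := hX.setIntegral_comp_add (Lp.stronglyMeasurable b) hbi 0 t hF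
  rw [add_zero] at h3
  rw [← L2.inner_indicatorConstLp_one (𝕜 := ℝ) hB hB'.ne, inner_semigroup, h1,
    L2.inner_indicatorConstLp_one (𝕜 := ℝ) hF',
    setIntegral_congr_ae hF' ((hX.coeFn_compLp t b).mono fun ω h _ => h), h3]
  exact hX.setIntegral_comp_eq 0 (hX.integrable_semigroupAct hbi t).aestronglyMeasurable hB

lemma integral_mul_comp_add {Z : Ω → ℝ} {s : ℝ≥0} (hZ : StronglyMeasurable[ℱ s] Z)
    (hZ2 : MemLp Z 2 Pm) (t : ℝ≥0) (b : Lp ℝ 2 μ) :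
    ∫ ω, Z ω * b (X (t + s) ω) ∂Pm = ∫ ω, Z ω * hX.semigroup t b (X s ω) ∂Pm := by
  rw [hX.integral_mul_comp_add_semigroupAct hZ hZ2]
  refine integral_congr_ae ?_
  filter_upwards [(hX.measurePreserving s).quasiMeasurePreserving.ae (hX.coeFn_semigroup t b)]
    with ω h
  rw [h]

lemma inner_compLp (s t : ℝ≥0) (a b : Lp ℝ 2 μ) :
    inner ℝ (hX.compLp s a) (hX.compLp t b) = ∫ ω, a (X s ω) * b (X t ω) ∂Pm := by
  rw [L2.inner_def]
  refine integral_congr_ae ?_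
  filter_upwards [hX.coeFn_compLp s a, hX.coeFn_compLp t b] with ω h1 h2
  rw [h1, h2]
  simp [mul_comm]

lemma semigroup_zero (g : Lp ℝ 2 μ) : hX.semigroup 0 g = g := by
  refine ext_inner_left ℝ fun a => ?_
  rw [inner_semigroup, LinearIsometry.inner_map_map]

lemma semigroup_add (s t : ℝ≥0) (g : Lp ℝ 2 μ) :
    hX.semigroup (s + t) g = hX.semigroup s (hX.semigroup t g) := by
  refine ext_inner_left ℝ fun a => ?_
  rw [inner_semigroup, inner_semigroup, inner_compLp, inner_compLp, add_comm s t]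
  refine hX.integral_mul_comp_add ?_ ?_ t g
  · exact (Lp.stronglyMeasurable a).comp_measurable ((hX.adapted 0).mono (ℱ.mono zero_le) le_rfl)
  · exact (Lp.memLp a).comp_measurePreserving (hX.measurePreserving 0)

lemma norm_semigroup_sub_le (s t : ℝ≥0) (g g' : Lp ℝ 2 μ) :
    ‖hX.semigroup s g - hX.semigroup t g'‖ ≤ ‖hX.compLp s g - hX.compLp t g'‖ := by
  have h : hX.semigroup s g - hX.semigroup t g' =
      (hX.compLp 0).toContinuousLinearMap.adjoint (hX.compLp s g - hX.compLp t g') := by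
    simp [semigroup, map_sub]
  rw [h]
  refine (ContinuousLinearMap.le_opNorm _ _).trans ?_
  rw [LinearIsometryEquiv.norm_map]
  exact mul_le_of_le_one_left (norm_nonneg _) (hX.compLp 0).norm_toContinuousLinearMap_le

lemma norm_semigroup_le (t : ℝ≥0) (g : Lp ℝ 2 μ) : ‖hX.semigroup t g‖ ≤ ‖g‖ := by
  simpa using hX.norm_semigroup_sub_le t t g 0

lemma tendsto_compLp_of_bounded [OpensMeasurableSpace 𝓧] (φ : BoundedContinuousFunction 𝓧 ℝ)
    (g : Lp ℝ 2 μ) (hg : g =ᵐ[μ] φ) :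
    Tendsto (fun t => hX.compLp t g) (𝓝 0) (𝓝 (hX.compLp 0 g)) := by
  have := hX.isProb
  have h2 (t : ℝ≥0) : ‖hX.compLp t g - hX.compLp 0 g‖ ^ 2
      = ∫ ω, (φ (X t ω) - φ (X 0 ω)) ^ 2 ∂Pm := by
    rw [← real_inner_self_eq_norm_sq, L2.inner_def]
    refine integral_congr_ae ?_
    filter_upwards [Lp.coeFn_sub (hX.compLp t g) (hX.compLp 0 g), hX.coeFn_compLp t g,
      hX.coeFn_compLp 0 g, (hX.measurePreserving t).quasiMeasurePreserving.ae hg,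
      (hX.measurePreserving 0).quasiMeasurePreserving.ae hg] with ω h1 h2 h3 h4 h5
    rw [h1, Pi.sub_apply, h2, h3, h4, h5]
    simp [sq]
  have h3 : Tendsto (fun t => ∫ ω, (φ (X t ω) - φ (X 0 ω)) ^ 2 ∂Pm) (𝓝 0)
      (𝓝 (∫ _, (0 : ℝ) ∂Pm)) := by
    refine tendsto_integral_filter_of_dominated_convergence (fun _ => (2 * ‖φ‖) ^ 2) ?_ ?_
      (integrable_const _) ?_
    · refine Eventually.of_forall fun t => ?_
      have hm (t : ℝ≥0) : Measurable fun ω => φ (X t ω) :=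
        φ.continuous.measurable.comp (hX.measurable t)
      exact (((hm t).sub (hm 0)).pow_const 2).aestronglyMeasurable
    · refine Eventually.of_forall fun t => Eventually.of_forall fun ω => ?_
      rw [norm_pow]
      gcongr
      exact φ.dist_le_two_norm _ _
    · refine Eventually.of_forall fun ω => ?_
      have hc := hX.rightCont ω 0
      have huniv : Ici (0 : ℝ≥0) = univ := by ext; simp
      rw [huniv, continuousWithinAt_univ] at hc
      have := ((φ.continuous.continuousAt.comp hc).tendsto.sub_const (φ (X 0 ω))).pow 2
      simpa using this
  rw [tendsto_iff_norm_sub_tendsto_zero]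
  simp_rw [← h2] at h3
  rw [integral_zero] at h3
  have := h3.sqrt
  simpa [Real.sqrt_sq] using this

lemma tendsto_compLp [PolishSpace 𝓧] [BorelSpace 𝓧] (g : Lp ℝ 2 μ) :
    Tendsto (fun t => hX.compLp t g) (𝓝 0) (𝓝 (hX.compLp 0 g)) := by
  have := hX.isProbabilityMeasure
  let := TopologicalSpace.upgradeIsCompletelyMetrizable 𝓧
  have hd := BoundedContinuousFunction.toLp_denseRange (E := ℝ) (μ := μ) (p := 2) ℝ
    ENNReal.ofNat_ne_top
  rw [Metric.tendsto_nhds]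
  intro ε hε
  obtain ⟨φ, hφ⟩ := Metric.denseRange_iff.1 hd g (ε / 3) (by positivity)
  set g' := BoundedContinuousFunction.toLp (E := ℝ) 2 μ ℝ φ
  have h1 := hX.tendsto_compLp_of_bounded φ g' (BoundedContinuousFunction.coeFn_toLp 2 μ ℝ φ)
  filter_upwards [Metric.tendsto_nhds.1 h1 (ε / 3) (by positivity)] with t ht
  have h2 (t : ℝ≥0) : dist (hX.compLp t g) (hX.compLp t g') < ε / 3 := by
    rwa [(hX.compLp t).dist_map]
  calc _ ≤ _ := dist_triangle4 _ (hX.compLp t g') (hX.compLp 0 g') _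
    _ < ε / 3 + ε / 3 + ε / 3 := by
      have := h2 0
      rw [dist_comm] at this
      gcongr
      exact h2 t
    _ = ε := by ring

/-- Right-continuity of the paths makes the transition semigroup strongly continuous. -/
lemma isContractionSemigroup [PolishSpace 𝓧] [BorelSpace 𝓧] :
    IsContractionSemigroup hX.semigroup where
  zero := hX.semigroup_zero
  add := hX.semigroup_add
  norm_le := hX.norm_semigroup_le
  continuous g := by
    have hle (s t : ℝ≥0) : ‖hX.semigroup s g - hX.semigroup t g‖
        ≤ ‖hX.compLp (max s t - min s t) g - hX.compLp 0 g‖ := by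
      wlog hst : s ≤ t generalizing s t
      · rw [norm_sub_rev, max_comm, min_comm]
        exact this t s (le_of_not_ge hst)
      obtain ⟨r, rfl⟩ := exists_add_of_le hst
      rw [max_eq_right hst, min_eq_left hst, add_tsub_cancel_left, semigroup_add, ← map_sub,
        norm_sub_rev (hX.compLp r g)]
      refine (hX.norm_semigroup_le _ _).trans ?_
      simpa [hX.semigroup_zero] using hX.norm_semigroup_sub_le 0 r g g
    rw [continuous_iff_continuousAt]
    intro t
    rw [ContinuousAt, tendsto_iff_norm_sub_tendsto_zero]
    refine squeeze_zero (fun _ => norm_nonneg _) (fun s => hle s t) ?_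
    have h0 := tendsto_iff_norm_sub_tendsto_zero.1 (hX.tendsto_compLp g)
    refine h0.comp ?_
    have : Continuous fun s : ℝ≥0 => max s t - min s t := by fun_prop
    simpa using this.tendsto t

/-- The generator is the strong derivative at `0` of the `L²` semigroup. -/
lemma isGenerator_iff (g h : Lp ℝ 2 μ) :
    IsGenerator p μ g h ↔
      Tendsto (fun t : ℝ≥0 => (t : ℝ)⁻¹ • (hX.semigroup t g - g)) (𝓝[>] 0) (𝓝 h) := by
  rw [tendsto_iff_edist_tendsto_0, IsGenerator]
  refine iff_of_eq (congrArg (fun F => Tendsto F _ _) ?_)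
  ext1 t
  rw [Lp.edist_def]
  refine eLpNorm_congr_ae ?_
  filter_upwards [Lp.coeFn_smul (t : ℝ)⁻¹ (hX.semigroup t g - g),
    Lp.coeFn_sub (hX.semigroup t g) g, hX.coeFn_semigroup t g] with x h1 h2 h3
  rw [Pi.sub_apply, h1, Pi.smul_apply, h2, Pi.sub_apply, h3, smul_eq_mul]

end IsStationaryMarkov

end

section

/-! ### Joint measurability of right-continuous processes -/

section Measurability

variable {Ω 𝓧 : Type*} [TopologicalSpace 𝓧] [MeasurableSpace 𝓧] [PolishSpace 𝓧] [BorelSpace 𝓧]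
  {X : ℝ≥0 → Ω → 𝓧}

omit [TopologicalSpace 𝓧] [PolishSpace 𝓧] [BorelSpace 𝓧] in
lemma measurable_uncurry_comp_nat {m : MeasurableSpace Ω} {Y : ℕ → Ω → 𝓧}
    (hY : ∀ j, Measurable (Y j)) {N : ℝ≥0 → ℕ} (hN : Measurable N) :
    Measurable fun q : Ω × ℝ≥0 => Y (N q.2) q.1 := by
  have h1 : Measurable fun q : Ω × ℕ => Y q.2 q.1 :=
    measurable_from_prod_countable_left fun j => hY j
  exact h1.comp (measurable_fst.prodMk (hN.comp measurable_snd))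

/-- A right-continuous process stopped at the fixed time `T` is jointly measurable with respect to
any σ-algebra that makes its values up to time `T` measurable. -/
lemma measurable_uncurry_min_of_rightCont {m : MeasurableSpace Ω} (T : ℝ≥0)
    (hm : ∀ t ≤ T, Measurable (X t))
    (hr : ∀ ω t, ContinuousWithinAt (fun r => X r ω) (Ici t) t) :
    Measurable fun q : Ω × ℝ≥0 => X (min q.2 T) q.1 := by
  let := TopologicalSpace.upgradeIsCompletelyMetrizable 𝓧
  set τ : ℕ → ℕ → ℝ≥0 := fun n j => min ((j + 1) / (n + 1)) T with hτ
  set N : ℕ → ℝ≥0 → ℕ := fun n t => ⌊t * (n + 1)⌋₊ with hN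
  refine measurable_of_tendsto_metrizable
    (f := fun (n : ℕ) (q : Ω × ℝ≥0) => X (τ n (N n q.2)) q.1) ?_ ?_
  · intro n
    have hc : Continuous fun t : ℝ≥0 => t * (n + 1) := by fun_prop
    exact measurable_uncurry_comp_nat (Y := fun j => X (τ n j))
      (fun j => hm (τ n j) (min_le_right _ _)) (Nat.measurable_floor.comp hc.measurable)
  · rw [tendsto_pi_nhds]
    rintro ⟨ω, t⟩
    have hlow (n : ℕ) : t ≤ (N n t + 1 : ℝ≥0) / (n + 1) := by
      rw [le_div_iff₀ (by positivity)]
      exact (Nat.lt_floor_add_one _).le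
    have hup (n : ℕ) : (N n t + 1 : ℝ≥0) / (n + 1) ≤ t + 1 / (n + 1) := by
      rw [add_div]
      gcongr
      rw [div_le_iff₀ (by positivity)]
      exact Nat.floor_le zero_le
    have hlim : Tendsto (fun n : ℕ => (N n t + 1 : ℝ≥0) / (n + 1)) atTop (𝓝 t) := by
      refine tendsto_of_tendsto_of_tendsto_of_le_of_le tendsto_const_nhds ?_ hlow hup
      simpa using (tendsto_one_div_add_atTop_nhds_zero_nat (𝕜 := ℝ≥0)).const_add t
    have hlim' : Tendsto (fun n : ℕ => τ n (N n t)) atTop (𝓝[Ici (min t T)] (min t T)) := by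
      refine tendsto_nhdsWithin_iff.2
        ⟨hlim.min tendsto_const_nhds, Eventually.of_forall fun n => ?_⟩
      exact min_le_min_right T (hlow n)
    exact (hr ω (min t T)).tendsto.comp hlim'

lemma measurable_uncurry_of_rightCont {m : MeasurableSpace Ω} (hm : ∀ t, Measurable (X t))
    (hr : ∀ ω t, ContinuousWithinAt (fun r => X r ω) (Ici t) t) :
    Measurable fun q : Ω × ℝ≥0 => X q.2 q.1 := by
  let := TopologicalSpace.upgradeIsCompletelyMetrizable 𝓧
  refine measurable_of_tendsto_metrizable
    (fun n : ℕ => measurable_uncurry_min_of_rightCont (n : ℝ≥0) (fun t _ => hm t) hr) ?_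
  rw [tendsto_pi_nhds]
  rintro ⟨ω, t⟩
  refine tendsto_const_nhds.congr' ?_
  filter_upwards [eventually_ge_atTop ⌈t⌉₊] with n hn
  have : t ≤ n := (Nat.le_ceil t).trans (by exact_mod_cast hn)
  simp [min_eq_left this]

lemma measurable_primitive {m : MeasurableSpace Ω} (T : ℝ≥0)
    (hm : ∀ t ≤ T, Measurable (X t))
    (hr : ∀ ω t, ContinuousWithinAt (fun r => X r ω) (Ici t) t) {V : 𝓧 → ℝ} (hV : Measurable V) :
    Measurable fun ω => primitive (fun t => V (X t ω)) T := by
  have h1 : ∀ ω, primitive (fun t => V (X t ω)) T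
      = ∫ u in Ioc (0 : ℝ) T, V (X (min u.toNNReal T) ω) := by
    intro ω
    rw [primitive, intervalIntegral.integral_of_le (NNReal.coe_nonneg T)]
    refine setIntegral_congr_fun measurableSet_Ioc fun u hu => ?_
    have : u.toNNReal ≤ T := Real.toNNReal_le_iff_le_coe.2 hu.2
    simp only [min_eq_left this]
  simp_rw [h1]
  have h2 : Measurable fun q : Ω × ℝ => V (X (min q.2.toNNReal T) q.1) :=
    hV.comp ((measurable_uncurry_min_of_rightCont T hm hr).comp
      (g := fun q : Ω × ℝ≥0 => X (min q.2 T) q.1)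
      (measurable_fst.prodMk (measurable_real_toNNReal.comp measurable_snd)))
  exact h2.stronglyMeasurable.integral_prod_right'.measurable

end Measurability

/-! ### Multiplication by an exponential weight -/

section Weight

variable {𝓧 : Type*} [MeasurableSpace 𝓧] {μ : Measure 𝓧}

lemma memLp_exp_mul {V : 𝓧 → ℝ} (hV : Measurable V) {C : ℝ} (hC : ∀ x, |V x| ≤ C) (h : ℝ≥0)
    (g : Lp ℝ 2 μ) : MemLp (fun x => Real.exp (h * V x) * g x) 2 μ := by
  refine (Lp.memLp g).of_le_mul (c := Real.exp (h * C))
    ((hV.const_mul _).exp.aestronglyMeasurable.mul (Lp.aestronglyMeasurable g))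
    (Eventually.of_forall fun x => ?_)
  rw [norm_mul, Real.norm_of_nonneg (Real.exp_pos _).le]
  gcongr
  exact (le_abs_self _).trans (hC x)

/-- The element `e^{hV} g` of `L²(μ)`. -/
noncomputable def expMul {V : 𝓧 → ℝ} (hV : Measurable V) {C : ℝ} (hC : ∀ x, |V x| ≤ C) (h : ℝ≥0)
    (g : Lp ℝ 2 μ) : Lp ℝ 2 μ :=
  (memLp_exp_mul hV hC h g).toLp _

variable {V : 𝓧 → ℝ} (hV : Measurable V) {C : ℝ} (hC : ∀ x, |V x| ≤ C)

lemma coeFn_expMul (h : ℝ≥0) (g : Lp ℝ 2 μ) :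
    expMul hV hC h g =ᵐ[μ] fun x => Real.exp (h * V x) * g x :=
  MemLp.coeFn_toLp _

lemma norm_expMul_le (h : ℝ≥0) (g : Lp ℝ 2 μ) :
    ‖expMul hV hC h g‖ ≤ Real.exp (h * C) * ‖g‖ := by
  refine Lp.norm_le_mul_norm_of_ae_le_mul ?_
  filter_upwards [coeFn_expMul hV hC h g] with x hx
  rw [hx, norm_mul, Real.norm_of_nonneg (Real.exp_pos _).le]
  gcongr
  exact (le_abs_self _).trans (hC x)

lemma norm_le_expMul (h : ℝ≥0) (g : Lp ℝ 2 μ) :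
    ‖g‖ ≤ Real.exp (h * C) * ‖expMul hV hC h g‖ := by
  refine Lp.norm_le_mul_norm_of_ae_le_mul ?_
  filter_upwards [coeFn_expMul hV hC h g] with x hx
  rw [hx, norm_mul, Real.norm_of_nonneg (Real.exp_pos _).le, ← mul_assoc, ← Real.exp_add]
  refine le_mul_of_one_le_left (norm_nonneg _) (Real.one_le_exp ?_)
  rw [← mul_add]
  exact mul_nonneg h.2 (by linarith [(abs_le.1 (hC x)).1])

lemma norm_sq_eq_integral (g : Lp ℝ 2 μ) : ‖g‖ ^ 2 = ∫ x, g x ^ 2 ∂μ := by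
  rw [← real_inner_self_eq_norm_sq, L2.inner_def]
  refine integral_congr_ae (Eventually.of_forall fun x => ?_)
  simp [sq]

include hV hC in
lemma integrable_mul_sq (g : Lp ℝ 2 μ) : Integrable (fun x => V x * g x ^ 2) μ :=
  (Lp.memLp g).integrable_sq.bdd_mul hV.aestronglyMeasurable (Eventually.of_forall hC)

lemma norm_expMul_sq_le (h : ℝ≥0) (hhC : h * C ≤ 1 / 2) (g : Lp ℝ 2 μ) :
    ‖expMul hV hC h g‖ ^ 2 ≤
      (1 + 4 * C ^ 2 * h ^ 2) * ‖g‖ ^ 2 + 2 * h * ∫ x, V x * g x ^ 2 ∂μ := by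
  have i1 : Integrable (fun x => g x ^ 2) μ := (Lp.memLp g).integrable_sq
  have i2 := integrable_mul_sq hV hC g
  rw [norm_sq_eq_integral, norm_sq_eq_integral, ← integral_const_mul, ← integral_const_mul,
    ← integral_add (i1.const_mul _) (i2.const_mul _)]
  refine integral_mono_ae (Lp.memLp _).integrable_sq ((i1.const_mul _).add (i2.const_mul _)) ?_
  filter_upwards [coeFn_expMul hV hC h g] with x hx
  have hVx : |V x| ≤ C := hC x
  have hC0 : 0 ≤ C := (abs_nonneg _).trans hVx
  have hh0 : (0 : ℝ) ≤ h := h.2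
  have hx2 : |2 * h * V x| ≤ 2 * h * C := by
    rw [abs_mul, abs_of_nonneg (by positivity : (0 : ℝ) ≤ 2 * h)]
    gcongr
  have hx1 : |2 * h * V x| ≤ 1 := hx2.trans (by linarith)
  have he := (abs_le.1 (Real.abs_exp_sub_one_sub_id_le hx1)).2
  have hsq : (2 * h * V x) ^ 2 ≤ (2 * h * C) ^ 2 := sq_le_sq' (by linarith [(abs_le.1 hx2).1])
    (abs_le.1 hx2).2
  have hexp : Real.exp (h * V x) ^ 2 = Real.exp (2 * h * V x) := by
    rw [← Real.exp_nat_mul]; congr 1; push_cast; ring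
  have : Real.exp (h * V x) ^ 2 ≤ 1 + 4 * C ^ 2 * h ^ 2 + 2 * h * V x := by
    rw [hexp]; nlinarith
  calc (expMul hV hC h g x) ^ 2 = Real.exp (h * V x) ^ 2 * g x ^ 2 := by rw [hx, mul_pow]
    _ ≤ (1 + 4 * C ^ 2 * h ^ 2 + 2 * h * V x) * g x ^ 2 := by gcongr
    _ = _ := by ring

end Weight

end

section

/-! ### The Feynman–Kac bound -/

namespace IsStationaryMarkov

variable {Ω 𝓧 : Type*} [mΩ : MeasurableSpace Ω] [TopologicalSpace 𝓧] [MeasurableSpace 𝓧]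
  [PolishSpace 𝓧] [BorelSpace 𝓧] {ℱ : Filtration ℝ≥0 mΩ} {X : ℝ≥0 → Ω → 𝓧}
  {p : ℝ≥0 → Kernel 𝓧 𝓧} {μ : Measure 𝓧} {Pm : Measure Ω} (hX : IsStationaryMarkov ℱ X p μ Pm)
  {V : 𝓧 → ℝ} (hV : Measurable V) {C : ℝ} (hC : ∀ x, |V x| ≤ C)

omit [PolishSpace 𝓧] [BorelSpace 𝓧] in
/-- The constant function `1` in `L²(μ)`. -/
noncomputable def oneLp (hX : IsStationaryMarkov ℱ X p μ Pm) : Lp ℝ 2 μ :=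
  have := hX.isProbabilityMeasure
  (memLp_const (1 : ℝ)).toLp _

omit [PolishSpace 𝓧] [BorelSpace 𝓧] in
lemma coeFn_oneLp : hX.oneLp =ᵐ[μ] fun _ => (1 : ℝ) :=
  have := hX.isProbabilityMeasure
  MemLp.coeFn_toLp (memLp_const 1)

omit [PolishSpace 𝓧] [BorelSpace 𝓧] in
lemma norm_oneLp : ‖hX.oneLp‖ = 1 := by
  have := hX.isProbabilityMeasure
  have h : ‖hX.oneLp‖ ^ 2 = 1 := by
    rw [norm_sq_eq_integral, integral_congr_ae (g := fun _ => (1 : ℝ))]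
    · simp
    · filter_upwards [hX.coeFn_oneLp] with x hx
      rw [hx, one_pow]
  exact (sq_eq_one_iff.1 h).resolve_right (by linarith [norm_nonneg hX.oneLp])

/-- The iterates `G_0 = 1`, `G_{n+1} = (1 - hA)⁻¹ (e^{hV} G_n)`, a time discretization of the
Feynman–Kac semigroup of `A + V`. -/
noncomputable def feynmanKacStep (h : ℝ≥0) : ℕ → Lp ℝ 2 μ
  | 0 => hX.oneLp
  | n + 1 => resolvent hX.semigroup h (expMul hV hC h (feynmanKacStep h n))

include hX in
lemma measurable_sampledExp_comp (hV : Measurable V) (h : ℝ≥0) (n : ℕ) :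
    Measurable fun q : Ω × ℝ≥0 => sampledExp h (fun t => V (X t q.1)) n q.2 :=
  measurable_sampledExp h (ψ := fun ω t => V (X t ω))
    (hV.comp (measurable_uncurry_of_rightCont hX.measurable hX.rightCont)) n

/-- The Markov property, applied successively at the sampling times. -/
lemma integral_mul_sampledExp (h : ℝ≥0) (n : ℕ) (s : ℝ≥0) {Z : Ω → ℝ}
    (hZ : StronglyMeasurable[ℱ s] Z) {B : ℝ} (hB : ∀ ω, |Z ω| ≤ B) :
    ∫ ω, Z ω * sampledExp h (fun t => V (X t ω)) n s ∂Pm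
      = ∫ ω, Z ω * hX.feynmanKacStep hV hC h n (X s ω) ∂Pm := by
  have := hX.isProb
  induction n generalizing s Z B with
  | zero =>
    refine integral_congr_ae ?_
    filter_upwards [(hX.measurePreserving s).quasiMeasurePreserving.ae hX.coeFn_oneLp] with ω hω
    simp only [feynmanKacStep, sampledExp, hω]
  | succ n ih =>
    have hXm : Measurable fun q : Ω × ℝ≥0 => X q.2 q.1 :=
      measurable_uncurry_of_rightCont hX.measurable hX.rightCont
    have hJm := hX.measurable_sampledExp_comp hV h n
    have hZm : Measurable Z := (hZ.mono (ℱ.le s)).measurable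
    have hZ2 : MemLp Z 2 Pm :=
      MemLp.of_bound hZm.aestronglyMeasurable B (Eventually.of_forall hB)
    set K : Ω → ℝ≥0 → ℝ := fun ω y => Z ω * (Real.exp (h * V (X (s + y) ω)) *
      sampledExp h (fun t => V (X t ω)) n (s + y)) with hK
    have hKm : Measurable (Function.uncurry K) := by
      have hsh : Measurable fun q : Ω × ℝ≥0 => (q.1, s + q.2) := by fun_prop
      exact (hZm.comp measurable_fst).mul
        (((hV.comp (hXm.comp hsh)).const_mul _).exp.mul (hJm.comp hsh))
    have hKi : Integrable (Function.uncurry K) (Pm.prod (expLaw h)) := by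
      refine Integrable.of_bound hKm.aestronglyMeasurable (B * Real.exp (h * C) ^ (n + 1))
        (Eventually.of_forall fun q => ?_)
      have hψC : ∀ t, |V (X t q.1)| ≤ C := fun t => hC _
      have h0 := sampledExp_nonneg (h := h) (ψ := fun t => V (X t q.1)) n (s + q.2)
      simp only [Function.uncurry, hK]
      rw [norm_mul, pow_succ', Real.norm_of_nonneg (mul_nonneg (Real.exp_pos _).le h0)]
      have hB0 : 0 ≤ B := (abs_nonneg _).trans (hB q.1)
      exact mul_le_mul (hB _) (mul_le_mul (exp_mul_le (ψ := fun t => V (X t q.1)) hψC _)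
        (sampledExp_le hψC _ _) h0 (Real.exp_pos _).le)
        (mul_nonneg (Real.exp_pos _).le h0) hB0
    set G := expMul hV hC h (hX.feynmanKacStep hV hC h n) with hG
    have hstep : ∀ y, ∫ ω, K ω y ∂Pm = ∫ ω, Z ω * hX.semigroup y G (X s ω) ∂Pm := by
      intro y
      have hZ' : StronglyMeasurable[ℱ (s + y)] fun ω => Z ω * Real.exp (h * V (X (s + y) ω)) :=
        (hZ.mono (ℱ.mono le_self_add)).mul
          ((hV.comp (hX.adapted (s + y))).const_mul _).exp.stronglyMeasurable
      have hB' : ∀ ω, |Z ω * Real.exp (h * V (X (s + y) ω))| ≤ B * Real.exp (h * C) := by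
        intro ω
        rw [abs_mul, Real.abs_exp]
        exact mul_le_mul (hB ω) (exp_mul_le (ψ := fun t => V (X t ω)) (fun t => hC _) _)
          (Real.exp_pos _).le ((abs_nonneg _).trans (hB ω))
      have h1 := ih (s + y) hZ' hB'
      simp only [mul_assoc] at h1
      rw [hK]
      simp only
      rw [h1, ← hX.integral_mul_comp_add hZ hZ2 y G, add_comm y s]
      refine integral_congr_ae ?_
      filter_upwards [(hX.measurePreserving (s + y)).quasiMeasurePreserving.ae
        (coeFn_expMul hV hC h (hX.feynmanKacStep hV hC h n))] with ω hω
      rw [hG, hω]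
    have hL (g : Lp ℝ 2 μ) : ∫ ω, Z ω * g (X s ω) ∂Pm
        = inner ℝ (hZ2.toLp Z) (hX.compLp s g) := by
      rw [L2.inner_def]
      refine integral_congr_ae ?_
      filter_upwards [hZ2.coeFn_toLp, hX.coeFn_compLp s g] with ω h1 h2
      rw [h1, h2]
      simp [mul_comm]
    have hcomm := ContinuousLinearMap.integral_comp_comm
      ((innerSL ℝ (hZ2.toLp Z)).comp (hX.compLp s).toContinuousLinearMap)
      (hX.isContractionSemigroup.integrable h G)
    calc ∫ ω, Z ω * sampledExp h (fun t => V (X t ω)) (n + 1) s ∂Pm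
        = ∫ ω, ∫ y, K ω y ∂expLaw h ∂Pm := by
          refine integral_congr_ae (Eventually.of_forall fun ω => ?_)
          simp only [hK, sampledExp, integral_const_mul]
      _ = ∫ y, ∫ ω, K ω y ∂Pm ∂expLaw h := integral_integral_swap hKi
      _ = ∫ y, inner ℝ (hZ2.toLp Z) (hX.compLp s (hX.semigroup y G)) ∂expLaw h := by
          simp_rw [hstep, hL]
      _ = inner ℝ (hZ2.toLp Z) (hX.compLp s (resolvent hX.semigroup h G)) := hcomm
      _ = _ := (hL _).symm

/-- One step of the discretization grows by at most the factor `1 + h κ + O(h²)` in `L²(μ)`. The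
resolvent `w = (1 - hA)⁻¹ g` satisfies `‖g‖² ≥ ‖w‖² - 2h ⟨A w, w⟩`, so that the form of `A + V` at
`w` controls the growth. -/
lemma norm_expMul_resolvent_sq_le {k : ℝ} (hk : 0 ≤ k)
    (hform : ∀ g v : Lp ℝ 2 μ, IsGenerator p μ g v →
      inner ℝ v g + ∫ x, V x * g x ^ 2 ∂μ ≤ k * ‖g‖ ^ 2)
    {h : ℝ≥0} (hh : 0 < h) (hhC : h * C ≤ 1 / 2) (g : Lp ℝ 2 μ) :
    ‖expMul hV hC h (resolvent hX.semigroup h g)‖ ^ 2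
      ≤ (1 + 2 * h * k + 4 * C ^ 2 * h ^ 2) * ‖g‖ ^ 2 := by
  have hU := hX.isContractionSemigroup
  have hh' : (0 : ℝ) < h := hh
  set w := resolvent hX.semigroup h g with hw
  set v := (h : ℝ)⁻¹ • (w - g) with hv
  have hgen : IsGenerator p μ w v := (hX.isGenerator_iff w v).2 (hU.tendsto_resolvent hh g)
  have hgw : g = w - (h : ℝ) • v := by
    rw [hv, smul_smul, mul_inv_cancel₀ hh'.ne', one_smul, sub_sub_cancel]
  have h1 : ‖w‖ ^ 2 - 2 * h * inner ℝ v w ≤ ‖g‖ ^ 2 := by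
    rw [hgw, norm_sub_sq_real, inner_smul_right, real_inner_comm]
    nlinarith [sq_nonneg ‖(h : ℝ) • v‖]
  have h2 := hform w v hgen
  have h3 := norm_expMul_sq_le hV hC h hhC w
  have h4 : ‖w‖ ^ 2 ≤ ‖g‖ ^ 2 := by
    have := hU.norm_resolvent_le h g
    gcongr
  have h5 := mul_le_mul_of_nonneg_left h2 (by positivity : (0 : ℝ) ≤ 2 * h)
  have h6 := mul_le_mul_of_nonneg_left h4
    (by positivity : (0 : ℝ) ≤ 2 * h * k + 4 * C ^ 2 * h ^ 2)
  nlinarith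

lemma norm_expMul_feynmanKacStep_sq_le {k : ℝ} (hk : 0 ≤ k)
    (hform : ∀ g v : Lp ℝ 2 μ, IsGenerator p μ g v →
      inner ℝ v g + ∫ x, V x * g x ^ 2 ∂μ ≤ k * ‖g‖ ^ 2)
    {h : ℝ≥0} (hh : 0 < h) (hhC : h * C ≤ 1 / 2) (n : ℕ) :
    ‖expMul hV hC h (hX.feynmanKacStep hV hC h n)‖ ^ 2
      ≤ (1 + 2 * h * k + 4 * C ^ 2 * h ^ 2) ^ n * Real.exp (h * C) ^ 2 := by
  induction n with
  | zero =>
    rw [pow_zero, one_mul]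
    have := norm_expMul_le hV hC h hX.oneLp
    rw [norm_oneLp, mul_one] at this
    exact pow_le_pow_left₀ (norm_nonneg _) this 2
  | succ n ih =>
    refine (hX.norm_expMul_resolvent_sq_le hV hC hk hform hh hhC _).trans ?_
    have h0 : 0 ≤ 1 + 2 * h * k + 4 * C ^ 2 * h ^ 2 := by positivity
    exact (mul_le_mul_of_nonneg_left ih h0).trans_eq (by ring)

include hX hV hC in
lemma integral_sampledExp_le {k : ℝ} (hk : 0 ≤ k)
    (hform : ∀ g v : Lp ℝ 2 μ, IsGenerator p μ g v →
      inner ℝ v g + ∫ x, V x * g x ^ 2 ∂μ ≤ k * ‖g‖ ^ 2)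
    {h : ℝ≥0} (hh : 0 < h) (hhC : h * C ≤ 1 / 2) (n : ℕ) :
    ∫ ω, sampledExp h (fun t => V (X t ω)) n 0 ∂Pm
      ≤ Real.exp (2 * (h * C) + n * (h * k + 2 * C ^ 2 * h ^ 2)) := by
  have h1 := hX.integral_mul_sampledExp hV hC h n 0 (Z := fun _ => 1)
    stronglyMeasurable_const (B := 1) (by simp)
  simp only [one_mul] at h1
  set G := hX.feynmanKacStep hV hC h n
  have h2 : ∫ ω, G (X 0 ω) ∂Pm = inner ℝ (hX.compLp 0 hX.oneLp) (hX.compLp 0 G) := by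
    rw [inner_compLp]
    refine integral_congr_ae ?_
    filter_upwards [(hX.measurePreserving 0).quasiMeasurePreserving.ae hX.coeFn_oneLp] with ω hω
    rw [hω, one_mul]
  have h3 : inner ℝ (hX.compLp 0 hX.oneLp) (hX.compLp 0 G) ≤ ‖G‖ := by
    refine (real_inner_le_norm _ _).trans ?_
    simp [norm_oneLp]
  have h4 := norm_le_expMul hV hC h G
  have hexp : (Real.exp (h * C + n * (h * k + 2 * C ^ 2 * h ^ 2))) ^ 2
      = Real.exp (2 * h * k + 4 * C ^ 2 * h ^ 2) ^ n * Real.exp (h * C) ^ 2 := by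
    rw [← Real.exp_nat_mul, ← Real.exp_nat_mul, ← Real.exp_nat_mul, ← Real.exp_add]
    congr 1
    push_cast
    ring
  have h5 : ‖expMul hV hC h G‖ ≤ Real.exp (h * C + n * (h * k + 2 * C ^ 2 * h ^ 2)) := by
    refine le_of_sq_le_sq ?_ (Real.exp_pos _).le
    refine (hX.norm_expMul_feynmanKacStep_sq_le hV hC hk hform hh hhC n).trans ?_
    rw [hexp]
    gcongr
    linarith [Real.add_one_le_exp (2 * h * k + 4 * C ^ 2 * h ^ 2)]
  rw [h1, h2]
  refine h3.trans (h4.trans ?_)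
  refine (mul_le_mul_of_nonneg_left h5 (Real.exp_pos _).le).trans_eq ?_
  rw [← Real.exp_add]
  congr 1
  ring

include hX hV hC in
/-- The Feynman–Kac bound `E[exp (∫_0^T V(X_t) dt)] ≤ e^{kT}`, for every `k ≥ 0` that bounds the
quadratic form of `A + V`. -/
theorem integral_exp_primitive_le {k : ℝ} (hk : 0 ≤ k)
    (hform : ∀ g v : Lp ℝ 2 μ, IsGenerator p μ g v →
      inner ℝ v g + ∫ x, V x * g x ^ 2 ∂μ ≤ k * ‖g‖ ^ 2)
    {T : ℝ≥0} (hT : 0 < T) :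
    ∫ ω, Real.exp (primitive (fun t => V (X t ω)) T) ∂Pm ≤ Real.exp (T * k) := by
  have := hX.isProb
  have hT' : (0 : ℝ) < T := hT
  have hXm : Measurable fun q : Ω × ℝ≥0 => X q.2 q.1 :=
    measurable_uncurry_of_rightCont hX.measurable hX.rightCont
  have hψ (ω : Ω) : Measurable fun t => V (X t ω) := hV.comp (hXm.comp measurable_prodMk_left)
  have hψC (ω : Ω) : ∀ t, |V (X t ω)| ≤ C := fun t => hC _
  have hn (δ : ℝ) (hδ : 0 < δ) (n : ℕ) (hn0 : 0 < n) (hnC : T / n * C ≤ 1 / 2) :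
      ∫ ω, Real.exp (primitive (fun t => V (X t ω)) T) ∂Pm
        ≤ Real.exp (C * δ / 2 + T * k
          + (C * T ^ 2 / (2 * δ) + 2 * (T * C) + 2 * C ^ 2 * T ^ 2) * (1 / n)) := by
    set h : ℝ≥0 := T / n with hh
    have hn' : (0 : ℝ) < n := by exact_mod_cast hn0
    have hh0 : 0 < h := div_pos hT (by exact_mod_cast hn0)
    have hhr : (h : ℝ) = T / n := by rw [hh]; push_cast; rfl
    have herr : samplingError h T C δ n 0 = C * δ / 2 + C * T ^ 2 / (2 * δ) * (1 / n) := by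
      rw [samplingError, hhr]
      simp only [NNReal.coe_zero]
      field_simp
      ring
    have hpt (ω : Ω) : Real.exp (primitive (fun t => V (X t ω)) T)
        ≤ Real.exp (samplingError h T C δ n 0) * sampledExp h (fun t => V (X t ω)) n 0 := by
      have h1 := exp_primitive_le_sampledExp (h := h) (hψ ω) (hψC ω) T hδ n 0
      have h2 : primitive (fun t => V (X t ω)) 0 = 0 := by simp [primitive]
      rw [h2, sub_zero] at h1
      calc _ = Real.exp (samplingError h T C δ n 0) * Real.exp
            (primitive (fun t => V (X t ω)) T - samplingError h T C δ n 0) := by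
              rw [← Real.exp_add]; congr 1; ring
        _ ≤ _ := by gcongr
    have hJm : Measurable fun ω => sampledExp h (fun t => V (X t ω)) n 0 :=
      (hX.measurable_sampledExp_comp hV h n).comp measurable_prodMk_right
    have hJi : Integrable (fun ω => sampledExp h (fun t => V (X t ω)) n 0) Pm :=
      Integrable.of_bound hJm.aestronglyMeasurable (Real.exp (h * C) ^ n)
        (Eventually.of_forall fun ω => by
          rw [Real.norm_of_nonneg (sampledExp_nonneg _ _)]
          exact sampledExp_le (hψC ω) _ _)
    calc _ ≤ ∫ ω, Real.exp (samplingError h T C δ n 0)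
            * sampledExp h (fun t => V (X t ω)) n 0 ∂Pm :=
          integral_mono_of_nonneg (Eventually.of_forall fun ω => (Real.exp_pos _).le)
            (hJi.const_mul _) (Eventually.of_forall hpt)
      _ ≤ Real.exp (samplingError h T C δ n 0)
            * Real.exp (2 * (h * C) + n * (h * k + 2 * C ^ 2 * h ^ 2)) := by
          rw [integral_const_mul]
          gcongr
          exact hX.integral_sampledExp_le hV hC hk hform hh0 (by rw [hhr]; exact hnC) n
      _ = _ := by
          rw [← Real.exp_add, herr, hhr]
          congr 1
          field_simp
          ring
  have hinv : Tendsto (fun n : ℕ => (1 : ℝ) / n) atTop (𝓝 0) := tendsto_one_div_atTop_nhds_zero_nat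
  have hδ (δ : ℝ) (hδ : 0 < δ) :
      ∫ ω, Real.exp (primitive (fun t => V (X t ω)) T) ∂Pm ≤ Real.exp (C * δ / 2 + T * k) := by
    have hlim : Tendsto (fun n : ℕ => Real.exp (C * δ / 2 + T * k
          + (C * T ^ 2 / (2 * δ) + 2 * (T * C) + 2 * C ^ 2 * T ^ 2) * (1 / n))) atTop
        (𝓝 (Real.exp (C * δ / 2 + T * k
          + (C * T ^ 2 / (2 * δ) + 2 * (T * C) + 2 * C ^ 2 * T ^ 2) * 0))) :=
      (Real.continuous_exp.tendsto _).comp ((hinv.const_mul _).const_add _)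
    rw [mul_zero, add_zero] at hlim
    refine ge_of_tendsto hlim ?_
    have hsmall : Tendsto (fun n : ℕ => T * C * ((1 : ℝ) / n)) atTop (𝓝 (T * C * 0)) :=
      hinv.const_mul _
    rw [mul_zero] at hsmall
    filter_upwards [eventually_gt_atTop 0, hsmall.eventually_le_const one_half_pos] with n h0 h1
    exact hn δ hδ n h0 (by rw [div_mul_eq_mul_div, ← mul_one_div]; exact h1)
  have hlim : Tendsto (fun δ : ℝ => Real.exp (C * δ / 2 + T * k)) (𝓝[>] 0)
      (𝓝 (Real.exp (C * 0 / 2 + T * k))) := by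
    have : Continuous fun δ : ℝ => Real.exp (C * δ / 2 + T * k) := by fun_prop
    exact (this.tendsto 0).mono_left nhdsWithin_le_nhds
  rw [mul_zero, zero_div, zero_add] at hlim
  refine ge_of_tendsto hlim ?_
  filter_upwards [self_mem_nhdsWithin] with δ h0
  exact hδ δ h0

end IsStationaryMarkov

end

section

/-! ### Mixtures of initial conditions -/

section Mixture

variable {Ω 𝓧 : Type*} [mΩ : MeasurableSpace Ω] [MeasurableSpace 𝓧]
  {μ : Measure 𝓧} [hμ : IsProbabilityMeasure μ] {Q : 𝓧 → Measure Ω}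
  (hQ : ∀ F, MeasurableSet F → UniversallyMeasurable (fun x => Q x F))

lemma mixture_apply {F : Set Ω} (hF : MeasurableSet F) :
    mixture μ Q hQ F = ∫⁻ x, Q x F ∂μ :=
  Measure.ofMeasurable_apply F hF

lemma isProbabilityMeasure_mixture (h : ∀ x, IsProbabilityMeasure (Q x)) :
    IsProbabilityMeasure (mixture μ Q hQ) := by
  constructor
  rw [mixture_apply hQ MeasurableSet.univ]
  simp

lemma lintegral_mixture {Z : Ω → ℝ≥0∞} (hZ : Measurable Z) :
    AEMeasurable (fun x => ∫⁻ ω, Z ω ∂Q x) μ ∧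
      ∫⁻ ω, Z ω ∂mixture μ Q hQ = ∫⁻ x, ∫⁻ ω, Z ω ∂Q x ∂μ := by
  refine Measurable.ennreal_induction (motive := fun Z => AEMeasurable (fun x => ∫⁻ ω, Z ω ∂Q x) μ ∧
      ∫⁻ ω, Z ω ∂mixture μ Q hQ = ∫⁻ x, ∫⁻ ω, Z ω ∂Q x ∂μ) ?_ ?_ ?_ hZ
  · intro c F hF
    have hm : AEMeasurable (fun x => Q x F) μ := (hQ F hF μ hμ).aemeasurable
    simp_rw [lintegral_indicator_const hF]
    refine ⟨hm.const_mul c, ?_⟩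
    rw [lintegral_const_mul'' _ hm, mixture_apply hQ hF]
  · intro f g _ hf hg ihf ihg
    simp only [Pi.add_apply, lintegral_add_left hf]
    exact ⟨ihf.1.add ihg.1, by rw [lintegral_add_left' ihf.1, ihf.2, ihg.2]⟩
  · intro f hf hmono ih
    simp only [lintegral_iSup hf hmono]
    refine ⟨AEMeasurable.iSup fun n => (ih n).1, ?_⟩
    rw [lintegral_iSup' (fun n => (ih n).1)
      (Eventually.of_forall fun x m n hmn => lintegral_mono (hmono hmn))]
    exact iSup_congr fun n => (ih n).2

end Mixture

variable {Ω 𝓧 : Type*} [mΩ : MeasurableSpace Ω] [MeasurableSpace 𝓧]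

lemma IsMarkovFamily.measure_inter [TopologicalSpace 𝓧] {ℱ : Filtration ℝ≥0 mΩ}
    {X : ℝ≥0 → Ω → 𝓧} {p : ℝ≥0 → Kernel 𝓧 𝓧} {P : 𝓧 → Measure Ω} (hP : IsMarkovFamily ℱ X p P)
    (x : 𝓧) (s t : ℝ≥0) {F : Set Ω} (hF : MeasurableSet[ℱ s] F) {B : Set 𝓧}
    (hB : MeasurableSet B) :
    P x (X (t + s) ⁻¹' B ∩ F) = ∫⁻ ω in F, p t (X s ω) B ∂P x := by
  have := hP.isProb x
  have := hP.isMarkovKernel t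
  have hXm (r : ℝ≥0) : Measurable (X r) := (hP.adapted r).mono (ℱ.le r) le_rfl
  have hpm : Measurable fun ω => p t (X s ω) B := (Kernel.measurable_coe (p t) hB).comp (hXm s)
  have h1 := setIntegral_condExp (μ := P x) (ℱ.le s)
    ((integrable_const (1 : ℝ)).indicator (hXm (t + s) hB)) hF
  rw [setIntegral_congr_ae (ℱ.le s _ hF) ((hP.markov x s t B hB).mono fun ω h _ => h),
    setIntegral_indicator (hXm (t + s) hB), setIntegral_const, smul_eq_mul, mul_one] at h1
  have h2 : ∫ ω in F, (p t (X s ω)).real B ∂P x = (∫⁻ ω in F, p t (X s ω) B ∂P x).toReal :=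
    integral_toReal hpm.aemeasurable (Eventually.of_forall fun ω => measure_lt_top _ _)
  rw [h2, measureReal_def] at h1
  have hfin : ∫⁻ ω in F, p t (X s ω) B ∂P x ≠ ∞ := by
    refine ((lintegral_mono fun ω => prob_le_one (μ := p t (X s ω)) (s := B)).trans_lt ?_).ne
    simp
  rw [inter_comm]
  exact ((ENNReal.toReal_eq_toReal_iff' hfin (measure_ne_top _ _)).1 h1).symm

/-- Started from an invariant law, a Markov family is a stationary Markov process. -/
lemma IsMarkovFamily.isStationaryMarkov [TopologicalSpace 𝓧] {ℱ : Filtration ℝ≥0 mΩ}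
    {X : ℝ≥0 → Ω → 𝓧} {p : ℝ≥0 → Kernel 𝓧 𝓧} {P : 𝓧 → Measure Ω} (hP : IsMarkovFamily ℱ X p P)
    (μ : Measure 𝓧) [IsProbabilityMeasure μ] (hinv : ∀ t, Kernel.Invariant (p t) μ) :
    IsStationaryMarkov ℱ X p μ (mixture μ P hP.univMeas) := by
  have hXm (r : ℝ≥0) : Measurable (X r) := (hP.adapted r).mono (ℱ.le r) le_rfl
  have hmarkov : ∀ s t F, MeasurableSet[ℱ s] F →
      ((mixture μ P hP.univMeas).restrict F).map (X (t + s))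
        = (((mixture μ P hP.univMeas).restrict F).map (X s)).bind (p t) := by
    intro s t F hF
    have hF' := ℱ.le s _ hF
    ext B hB
    have hpm : Measurable fun ω => p t (X s ω) B := (Kernel.measurable_coe (p t) hB).comp (hXm s)
    rw [Measure.map_apply (hXm _) hB, Measure.restrict_apply (hXm _ hB),
      mixture_apply _ ((hXm _ hB).inter hF'), Measure.bind_apply hB (p t).aemeasurable,
      lintegral_map (Kernel.measurable_coe (p t) hB) (hXm s), ← lintegral_indicator hF',
      (lintegral_mixture hP.univMeas (hpm.indicator hF')).2]
    refine lintegral_congr fun x => ?_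
    rw [hP.measure_inter x s t hF hB, lintegral_indicator hF']
  have h0 : (mixture μ P hP.univMeas).map (X 0) = μ := by
    ext B hB
    rw [Measure.map_apply (hXm _) hB, mixture_apply _ (hXm _ hB)]
    have (x : 𝓧) : P x (X 0 ⁻¹' B) = B.indicator 1 x := by
      rw [← Measure.map_apply (hXm _) hB, hP.map_zero, Measure.dirac_apply' _ hB]
    simp_rw [this]
    exact lintegral_indicator_one hB
  refine ⟨isProbabilityMeasure_mixture _ hP.isProb, hP.adapted, fun ω t => (hP.cadlag ω t).1,
    hP.isMarkovKernel, fun t => ?_, hmarkov⟩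
  have := hmarkov 0 t univ MeasurableSet.univ
  rw [Measure.restrict_univ, h0, add_zero] at this
  rw [this]
  exact hinv t

/-! ### The Donsker–Varadhan inequality -/

omit [MeasurableSpace 𝓧] in
lemma integral_le_klDiv_add_log {Qm Pm : Measure Ω} [IsProbabilityMeasure Qm]
    [IsProbabilityMeasure Pm] (hkl : InformationTheory.klDiv Qm Pm ≠ ∞) {φ : Ω → ℝ}
    (hφ : Integrable φ Qm) (hexp : Integrable (fun ω => Real.exp (φ ω)) Pm) :
    ∫ ω, φ ω ∂Qm ≤ (InformationTheory.klDiv Qm Pm).toReal + Real.log (∫ ω, Real.exp (φ ω) ∂Pm) := by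
  obtain ⟨hac, hint⟩ := InformationTheory.klDiv_ne_top_iff.1 hkl
  have := isProbabilityMeasure_tilted hexp
  -- The inequality is the nonnegativity of the relative entropy with respect to the tilted measure.
  have h1 := InformationTheory.integral_llr_add_sub_measure_univ_nonneg
    (hac.trans (absolutelyContinuous_tilted hexp)) (integrable_llr_tilted_right hac hφ hint hexp)
  rw [integral_llr_tilted_right hac hφ hexp hint] at h1
  rw [InformationTheory.toReal_klDiv hac hint]
  simp only [probReal_univ] at h1 ⊢
  linarith

omit [MeasurableSpace 𝓧] in
/-- The Donsker–Varadhan inequality for a bounded functional of the process up to time `T`. -/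
lemma integral_le_relEntropyUpTo_add_log {ℱ : Filtration ℝ≥0 mΩ} {T : ℝ≥0} {Qm Pm : Measure Ω}
    [IsProbabilityMeasure Qm] [IsProbabilityMeasure Pm] (hkl : relEntropyUpTo ℱ T Qm Pm ≠ ∞)
    {φ : Ω → ℝ} (hφ : Measurable[ℱ T] φ) {C : ℝ} (hC : ∀ ω, |φ ω| ≤ C) :
    ∫ ω, φ ω ∂Qm ≤ (relEntropyUpTo ℱ T Qm Pm).toReal
      + Real.log (∫ ω, Real.exp (φ ω) ∂Pm) := by
  have hle := ℱ.le T
  have hφs : StronglyMeasurable[ℱ T] φ := hφ.stronglyMeasurable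
  have hes : StronglyMeasurable[ℱ T] fun ω => Real.exp (φ ω) :=
    (Real.measurable_exp.comp hφ).stronglyMeasurable
  have : IsProbabilityMeasure (Qm.trim hle) :=
    ⟨by rw [trim_measurableSet_eq hle MeasurableSet.univ, measure_univ]⟩
  have : IsProbabilityMeasure (Pm.trim hle) :=
    ⟨by rw [trim_measurableSet_eq hle MeasurableSet.univ, measure_univ]⟩
  rw [integral_trim hle hφs, integral_trim hle hes]
  refine @integral_le_klDiv_add_log Ω (ℱ T) (Qm.trim hle) (Pm.trim hle) _ _ hkl φ ?_ ?_
  · exact Integrable.of_bound hφs.aestronglyMeasurable C (Eventually.of_forall hC)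
  · refine Integrable.of_bound hes.aestronglyMeasurable (Real.exp C)
      (Eventually.of_forall fun ω => ?_)
    rw [Real.norm_of_nonneg (Real.exp_pos _).le]
    exact Real.exp_le_exp.2 ((le_abs_self _).trans (hC ω))

end

section

/-! ### The cumulant bound `κ` -/

namespace IsStationaryMarkov

variable {Ω 𝓧 : Type*} [mΩ : MeasurableSpace Ω] [TopologicalSpace 𝓧] [MeasurableSpace 𝓧]
  {ℱ : Filtration ℝ≥0 mΩ} {X : ℝ≥0 → Ω → 𝓧}
  {p : ℝ≥0 → Kernel 𝓧 𝓧} {μ : Measure 𝓧} {Pm : Measure Ω} (hX : IsStationaryMarkov ℱ X p μ Pm)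
include hX

lemma isGenerator_oneLp : IsGenerator p μ hX.oneLp 0 := by
  have h1 (t : ℝ≥0) : hX.semigroup t hX.oneLp = hX.oneLp := by
    refine ext_inner_left ℝ fun a => ?_
    have hc (r : ℝ≥0) : hX.compLp r hX.oneLp =ᵐ[Pm] fun _ => (1 : ℝ) := by
      filter_upwards [hX.coeFn_compLp r hX.oneLp,
        (hX.measurePreserving r).quasiMeasurePreserving.ae hX.coeFn_oneLp] with ω h1 h2
      rw [h1, h2]
    have : hX.compLp t hX.oneLp = hX.compLp 0 hX.oneLp :=
      Lp.ext ((hc t).trans (hc 0).symm)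
    rw [inner_semigroup, this, LinearIsometry.inner_map_map]
  rw [hX.isGenerator_iff]
  simp [h1]

lemma isGenerator_smul {g v : Lp ℝ 2 μ} (h : IsGenerator p μ g v) (a : ℝ) :
    IsGenerator p μ (a • g) (a • v) := by
  rw [hX.isGenerator_iff] at h ⊢
  refine (h.const_smul a).congr fun t => ?_
  rw [map_smul, ← smul_sub, smul_comm]

/-- Testing the supremum with the constant function `1`. -/
lemma kappa_nonneg {V : 𝓧 → ℝ} (hV0 : ∫ x, V x ∂μ = 0) : 0 ≤ kappa p μ V := by
  refine le_sSup ⟨hX.oneLp, 0, hX.isGenerator_oneLp, hX.norm_oneLp, ?_⟩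
  have : ∫ x, V x * hX.oneLp x ^ 2 ∂μ = 0 := by
    rw [← hV0]
    refine integral_congr_ae ?_
    filter_upwards [hX.coeFn_oneLp] with x hx
    rw [hx, one_pow, mul_one]
  rw [this, inner_zero_left, add_zero, EReal.coe_zero]

lemma form_le_of_kappa_le {V : 𝓧 → ℝ} {k : ℝ} (hk : kappa p μ V ≤ k) (g v : Lp ℝ 2 μ)
    (hgv : IsGenerator p μ g v) : inner ℝ v g + ∫ x, V x * g x ^ 2 ∂μ ≤ k * ‖g‖ ^ 2 := by
  rcases eq_or_ne g 0 with hg | hg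
  · have h0 : ∫ x, V x * g x ^ 2 ∂μ = 0 := by
      have hg0 : g =ᵐ[μ] 0 := hg ▸ Lp.coeFn_zero ℝ 2 μ
      refine integral_eq_zero_of_ae ?_
      filter_upwards [hg0] with x hx
      simp [hx]
    rw [h0, hg, inner_zero_right, norm_zero]
    simp
  · have hpos : 0 < ‖g‖ := norm_pos_iff.2 hg
    have h1 : ‖‖g‖⁻¹ • g‖ = 1 := by
      rw [norm_smul, norm_inv, norm_norm, inv_mul_cancel₀ hpos.ne']
    have h2 : ((inner ℝ (‖g‖⁻¹ • v) (‖g‖⁻¹ • g)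
        + ∫ x, V x * (‖g‖⁻¹ • g : Lp ℝ 2 μ) x ^ 2 ∂μ : ℝ) : EReal) ≤ k :=
      (le_sSup ⟨_, _, hX.isGenerator_smul hgv ‖g‖⁻¹, h1, rfl⟩ : _ ≤ kappa p μ V).trans hk
    rw [EReal.coe_le_coe_iff] at h2
    have h3 : ∫ x, V x * (‖g‖⁻¹ • g : Lp ℝ 2 μ) x ^ 2 ∂μ
        = ‖g‖⁻¹ ^ 2 * ∫ x, V x * g x ^ 2 ∂μ := by
      rw [← integral_const_mul]
      refine integral_congr_ae ?_
      filter_upwards [Lp.coeFn_smul ‖g‖⁻¹ g] with x hx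
      rw [hx, Pi.smul_apply, smul_eq_mul]
      ring
    rw [h3, inner_smul_left, inner_smul_right] at h2
    simp only [conj_trivial] at h2
    have h4 := mul_le_mul_of_nonneg_right h2 (sq_nonneg ‖g‖)
    have h5 : ‖g‖⁻¹ * ‖g‖ = 1 := inv_mul_cancel₀ hpos.ne'
    calc _ = (‖g‖⁻¹ * ‖g‖) ^ 2 * (inner ℝ v g + ∫ x, V x * g x ^ 2 ∂μ) := by
            rw [h5, one_pow, one_mul]
      _ = (‖g‖⁻¹ * (‖g‖⁻¹ * inner ℝ v g) + ‖g‖⁻¹ ^ 2 * ∫ x, V x * g x ^ 2 ∂μ) * ‖g‖ ^ 2 := by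
            ring
      _ ≤ _ := h4

end IsStationaryMarkov

/-! ### The bias bound -/

section Bias

variable {Ω 𝓧 : Type*} [mΩ : MeasurableSpace Ω] [TopologicalSpace 𝓧] [MeasurableSpace 𝓧]
  [PolishSpace 𝓧] [BorelSpace 𝓧]
  {ℱ : Filtration ℝ≥0 mΩ} {X : ℝ≥0 → Ω → 𝓧}
  {p : ℝ≥0 → Kernel 𝓧 𝓧} {μ : Measure 𝓧} {Pm Qm : Measure Ω}

/-- The entropy bound for the time average of a bounded function `V`: Donsker–Varadhan combined
with the Feynman–Kac bound. -/
lemma IsStationaryMarkov.integral_primitive_le (hX : IsStationaryMarkov ℱ X p μ Pm)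
    [IsProbabilityMeasure Qm] {V : 𝓧 → ℝ} (hV : Measurable V) {C : ℝ} (hC : ∀ x, |V x| ≤ C)
    {k : ℝ} (hk0 : 0 ≤ k) (hk : kappa p μ V ≤ k) {T : ℝ≥0} (hT : 0 < T)
    (hkl : relEntropyUpTo ℱ T Qm Pm ≠ ∞) :
    ∫ ω, primitive (fun t => V (X t ω)) T ∂Qm ≤ (relEntropyUpTo ℱ T Qm Pm).toReal + T * k := by
  have := hX.isProb
  have hφ : Measurable[ℱ T] fun ω => primitive (fun t => V (X t ω)) T :=
    measurable_primitive T
      (fun t ht => (hX.adapted t).mono (ℱ.mono ht) le_rfl) hX.rightCont hV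
  have hb (ω : Ω) : |primitive (fun t => V (X t ω)) T| ≤ C * T :=
    abs_primitive_le (fun t => hC _) T
  have h1 := integral_le_relEntropyUpTo_add_log hkl hφ hb
  have h2 := hX.integral_exp_primitive_le hV hC hk0 (hX.form_le_of_kappa_le hk) hT
  have hei : Integrable (fun ω => Real.exp (primitive (fun t => V (X t ω)) T)) Pm := by
    refine Integrable.of_bound (((hφ.mono (ℱ.le T) le_rfl).exp).aestronglyMeasurable)
      (Real.exp (C * T)) (Eventually.of_forall fun ω => ?_)
    rw [Real.norm_of_nonneg (Real.exp_pos _).le]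
    exact Real.exp_le_exp.2 ((le_abs_self _).trans (hb ω))
  have h3 := Real.log_le_log (integral_exp_pos hei) h2
  rw [Real.log_exp] at h3
  linarith

lemma integral_primitive_eq (hXm : ∀ t, Measurable (X t))
    (hr : ∀ ω t, ContinuousWithinAt (fun r => X r ω) (Ici t) t) [IsProbabilityMeasure Qm]
    {f : 𝓧 → ℝ} (hf : Measurable f) {C : ℝ} (hC : ∀ x, |f x| ≤ C) (a : ℝ) {T : ℝ≥0}
    (hT : 0 < T) :
    ∫ ω, primitive (fun t => a * (f (X t ω) - ∫ y, f y ∂μ)) T ∂Qm = T * (a * bias X Qm μ f T) := by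
  have hT' : (0 : ℝ) < T := hT
  have hXj : Measurable fun q : Ω × ℝ≥0 => X q.2 q.1 := measurable_uncurry_of_rightCont hXm hr
  have h1 (ω : Ω) : primitive (fun t => a * (f (X t ω) - ∫ y, f y ∂μ)) T
      = a * (primitive (fun t => f (X t ω)) T - T * ∫ y, f y ∂μ) := by
    have hi := intervalIntegrable_path (ψ := fun t => f (X t ω))
      (hf.comp (hXj.comp measurable_prodMk_left)) (fun t => hC _) 0 T
    simp only [primitive]
    rw [intervalIntegral.integral_const_mul, intervalIntegral.integral_sub hi (by simp)]
    simp
  have hm : Measurable fun ω => primitive (fun t => f (X t ω)) T :=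
    measurable_primitive T (fun t _ => hXm t) hr hf
  have hi : Integrable (fun ω => primitive (fun t => f (X t ω)) T) Qm :=
    Integrable.of_bound hm.aestronglyMeasurable (C * T)
      (Eventually.of_forall fun ω => abs_primitive_le (fun t => hC _) T)
  simp_rw [h1]
  have hbias : bias X Qm μ f T
      = (T : ℝ)⁻¹ * ∫ ω, primitive (fun t => f (X t ω)) T ∂Qm - ∫ y, f y ∂μ := by
    rw [bias, integral_const_mul]
    rfl
  rw [integral_const_mul, integral_sub hi (integrable_const _), hbias]
  simp only [integral_const, probReal_univ, one_smul]
  field_simp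

lemma IsStationaryMarkov.bias_le_Xi (hX : IsStationaryMarkov ℱ X p μ Pm)
    [IsProbabilityMeasure Qm] {f : 𝓧 → ℝ} (hf : Measurable f) {C : ℝ} (hC : ∀ x, |f x| ≤ C)
    {T : ℝ≥0} (hT : 0 < T) (s : ℝ) :
    ((s * bias X Qm μ f T : ℝ) : EReal) ≤
      Xi s (fun c => kappa p μ fun x => c * (f x - ∫ y, f y ∂μ))
        (relEntropyUpTo ℱ T Qm Pm / T) := by
  have := hX.isProbabilityMeasure
  have hT' : (0 : ℝ) < T := hT
  have hfi : Integrable f μ :=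
    Integrable.of_bound hf.aestronglyMeasurable C (Eventually.of_forall hC)
  refine le_iInf₂ fun c hc => ?_
  set V : 𝓧 → ℝ := fun x => s * c * (f x - ∫ y, f y ∂μ) with hVdef
  have hV : Measurable V := (hf.sub_const _).const_mul _
  have hVC : ∀ x, |V x| ≤ |s * c| * (C + |∫ y, f y ∂μ|) := fun x => by
    rw [hVdef, abs_mul]
    exact mul_le_mul_of_nonneg_left ((abs_sub _ _).trans (by linarith [hC x])) (abs_nonneg _)
  have hV0 : ∫ x, V x ∂μ = 0 := by
    rw [hVdef, integral_const_mul, integral_sub hfi (integrable_const _)]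
    simp
  have hk0 := hX.kappa_nonneg hV0
  change _ ≤ (kappa p μ V + _) / _
  have hc0 : (0 : EReal) < c := EReal.coe_pos.2 hc
  set R := relEntropyUpTo ℱ T Qm Pm with hR
  have hηk : (0 : EReal) ≤ ((R / T : ℝ≥0∞) : EReal) := EReal.coe_ennreal_nonneg _
  by_cases hRtop : R = ∞
  · have h1 : ((R / T : ℝ≥0∞) : EReal) = ⊤ := by
      rw [hRtop, ENNReal.top_div_of_ne_top ENNReal.coe_ne_top, EReal.coe_ennreal_top]
    rw [h1, EReal.add_top_of_ne_bot (ne_bot_of_le_ne_bot (by simp) hk0),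
      EReal.top_div_of_pos_ne_top hc0 (EReal.coe_ne_top c)]
    exact le_top
  by_cases hktop : kappa p μ V = ⊤
  · rw [hktop, EReal.top_add_of_ne_bot (ne_bot_of_le_ne_bot (by simp) hηk),
      EReal.top_div_of_pos_ne_top hc0 (EReal.coe_ne_top c)]
    exact le_top
  lift kappa p μ V to ℝ using ⟨hktop, ne_bot_of_le_ne_bot (by simp) hk0⟩ with k hk
  have hk0' : 0 ≤ k := EReal.coe_nonneg.1 hk0
  have h1 := hX.integral_primitive_le (Qm := Qm) hV hVC hk0' hk.ge hT hRtop
  rw [hVdef, integral_primitive_eq hX.measurable hX.rightCont hf hC (s * c) hT] at h1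
  have hη : ((R / T : ℝ≥0∞) : EReal) = ((R.toReal / T : ℝ) : EReal) := by
    have hne : R / T ≠ ∞ := ENNReal.div_ne_top hRtop (by exact_mod_cast hT.ne')
    rw [← EReal.coe_toReal (x := ((R / T : ℝ≥0∞) : EReal)) (by simpa using hne) (by simp),
      EReal.toReal_coe_ennreal, ENNReal.toReal_div, ENNReal.coe_toReal]
  rw [hη, ← EReal.coe_add, ← EReal.coe_div, EReal.coe_le_coe_iff, le_div_iff₀ hc]
  have h2 : T * (s * bias X Qm μ f T * c) ≤ T * (k + R.toReal / T) := by
    rw [mul_add, mul_div_cancel₀ _ hT'.ne']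
    linarith
  exact le_of_mul_le_mul_left h2 hT'

end Bias

end

section

/-! ### The Bernstein-type bound under a Poincaré inequality -/

section Bernstein

variable {𝓧 : Type*} [MeasurableSpace 𝓧] {μ : Measure 𝓧} [IsProbabilityMeasure μ]

/-- For mean-zero `W` with `W ≤ M'`, the spectral gap `1 / α` controls the quadratic form of
`A + cW`: it is split along the constants, and the cross term is absorbed by the gap. -/
lemma kappa_const_mul_le {p : ℝ≥0 → Kernel 𝓧 𝓧} {α : ℝ} (hα : 0 < α)
    (hpoinc : PoincareInequality p μ α) {W : 𝓧 → ℝ} (hW : Measurable W) {C : ℝ}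
    (hC : ∀ x, |W x| ≤ C) (hW0 : ∫ x, W x ∂μ = 0) {M' : ℝ} (hM' : ∀ᵐ x ∂μ, W x ≤ M') {c : ℝ}
    (hc : 0 < c) (hcM : c * (α * M') < 1) :
    kappa p μ (fun x => c * W x)
      ≤ ((α * c ^ 2 * ∫ x, W x ^ 2 ∂μ) / (1 - c * (α * M')) : ℝ) := by
  refine sSup_le ?_
  rintro r ⟨g, v, hgen, hg1, rfl⟩
  rw [EReal.coe_le_coe_iff]
  set D : ℝ := 1 / α - c * M' with hD
  have hDα : D * α = 1 - c * (α * M') := by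
    rw [hD]
    field_simp
  have hD0 : 0 < D := by
    refine pos_of_mul_pos_left ?_ hα.le
    rw [hDα]
    linarith
  set a : ℝ := ∫ x, g x ∂μ with ha
  set q : ℝ := ∫ x, (g x - a) ^ 2 ∂μ with hq
  set w : ℝ := ∫ x, W x ^ 2 ∂μ with hw
  have hw0 : 0 ≤ w := integral_nonneg fun x => sq_nonneg _
  have hg2 : MemLp g 2 μ := Lp.memLp g
  have hga : MemLp (fun x => g x - a) 2 μ := hg2.sub (memLp_const a)
  have hvar : Var[g; μ] = q := variance_eq_integral hg2.aestronglyMeasurable.aemeasurable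
  have hqa : q + a ^ 2 = 1 := by
    have h1 := variance_eq_sub hg2
    have h2 := norm_sq_eq_integral g
    rw [hg1, one_pow] at h2
    simp only [Pi.pow_apply] at h1
    rw [hvar, ← h2] at h1
    linarith
  have hq0 : 0 ≤ q := integral_nonneg fun x => sq_nonneg _
  have hP : inner ℝ v g ≤ -(q / α) := by
    have := hpoinc g v hgen
    rw [hvar] at this
    rw [← neg_div, le_div_iff₀ hα]
    linarith
  have iW : Integrable W μ :=
    Integrable.of_bound hW.aestronglyMeasurable C (Eventually.of_forall hC)
  have iW2 : Integrable (fun x => W x ^ 2) μ :=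
    (MemLp.of_bound hW.aestronglyMeasurable C (Eventually.of_forall hC)).integrable_sq
  have iga : Integrable (fun x => (g x - a) ^ 2) μ := hga.integrable_sq
  have hint : ∫ x, c * W x * g x ^ 2 ∂μ ≤ c ^ 2 * a ^ 2 / D * w + (c * M' + D) * q := by
    have h1 : ∫ x, c * W x * g x ^ 2 ∂μ ≤ ∫ x, (c ^ 2 * a ^ 2 / D * W x ^ 2
        + (c * M' + D) * (g x - a) ^ 2 + c * a ^ 2 * W x) ∂μ := by
      refine integral_mono_ae ?_ (((iW2.const_mul _).add (iga.const_mul _)).add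
        (iW.const_mul _)) ?_
      · exact integrable_mul_sq (hW.const_mul c) (C := c * C)
          (fun x => by
            rw [abs_mul, abs_of_pos hc]
            exact mul_le_mul_of_nonneg_left (hC x) hc.le) g
      · filter_upwards [hM'] with x hx
        have e1 : 2 * (c * a * W x) * (g x - a)
            ≤ c ^ 2 * a ^ 2 / D * W x ^ 2 + D * (g x - a) ^ 2 := by
          have : c ^ 2 * a ^ 2 / D * W x ^ 2 + D * (g x - a) ^ 2
              - 2 * (c * a * W x) * (g x - a) = (c * a * W x - D * (g x - a)) ^ 2 / D := by
            field_simp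
            ring
          have h0 : 0 ≤ (c * a * W x - D * (g x - a)) ^ 2 / D := by positivity
          linarith
        have e2 : c * W x * (g x - a) ^ 2 ≤ c * M' * (g x - a) ^ 2 := by gcongr
        calc c * W x * g x ^ 2 = c * W x * (g x - a) ^ 2 + 2 * (c * a * W x) * (g x - a)
              + c * a ^ 2 * W x := by ring
          _ ≤ _ := by linarith
    refine h1.trans_eq ?_
    have j1 : Integrable (fun x => c ^ 2 * a ^ 2 / D * W x ^ 2) μ := iW2.const_mul _
    have j2 : Integrable (fun x => (c * M' + D) * (g x - a) ^ 2) μ := iga.const_mul _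
    have j12 : Integrable (fun x => c ^ 2 * a ^ 2 / D * W x ^ 2
        + (c * M' + D) * (g x - a) ^ 2) μ := j1.add j2
    rw [integral_add j12 (iW.const_mul _), integral_add j1 j2]
    simp only [integral_const_mul, hW0, mul_zero, add_zero]
    rfl
  have hcMD : c * M' + D = 1 / α := by rw [hD]; ring
  rw [hcMD] at hint
  have hlast : c ^ 2 * a ^ 2 / D * w ≤ c ^ 2 / D * w := by
    gcongr
    have : a ^ 2 ≤ 1 := by linarith
    nlinarith [sq_nonneg c]
  have heq : α * c ^ 2 * w / (1 - c * (α * M')) = c ^ 2 / D * w := by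
    rw [← hDα]
    field_simp
  rw [heq]
  have : 1 / α * q = q / α := by ring
  linarith

/-- With `c = 1 / (M + u)`, so that `1 - cM = uc`, the infimum over `c` becomes one over `u > 0`. -/
lemma Xi_le {p : ℝ≥0 → Kernel 𝓧 𝓧} {α : ℝ} (hα : 0 < α)
    (hpoinc : PoincareInequality p μ α) {f : 𝓧 → ℝ} (hf : Measurable f) {C : ℝ}
    (hC : ∀ x, |f x| ≤ C) {s : ℝ} (hs : s = 1 ∨ s = -1) {η : ℝ≥0∞} (hη : η ≠ ∞) {u : ℝ}
    (hu : 0 < u) :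
    Xi s (fun c => kappa p μ fun x => c * (f x - ∫ y, f y ∂μ)) η
      ≤ ((α * Var[f; μ] / u + η.toReal * (bernsteinM s α μ f + u) : ℝ) : EReal) := by
  set m := ∫ y, f y ∂μ with hm
  set W : 𝓧 → ℝ := fun x => s * (f x - m) with hWdef
  have hs2 : s ^ 2 = 1 := by rcases hs with rfl | rfl <;> norm_num
  have hsabs : |s| = 1 := by rcases hs with rfl | rfl <;> norm_num
  have hfi : Integrable f μ :=
    Integrable.of_bound hf.aestronglyMeasurable C (Eventually.of_forall hC)
  have hW : Measurable W := (hf.sub_const _).const_mul _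
  have hWC : ∀ x, |W x| ≤ C + |m| := fun x => by
    rw [hWdef, abs_mul, hsabs, one_mul]
    exact (abs_sub _ _).trans (by linarith [hC x])
  have hW0 : ∫ x, W x ∂μ = 0 := by
    rw [hWdef, integral_const_mul, integral_sub hfi (integrable_const _)]
    simp [hm]
  have hW2 : ∫ x, W x ^ 2 ∂μ = Var[f; μ] := by
    rw [variance_eq_integral hf.aemeasurable]
    refine integral_congr_ae (Eventually.of_forall fun x => ?_)
    simp only [hWdef, mul_pow, hs2, one_mul, hm]
  set M' : ℝ := (eLpNorm (fun x => max (W x) 0) ∞ μ).toReal with hM'def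
  have hM : bernsteinM s α μ f = α * M' := rfl
  have hM'0 : 0 ≤ M' := ENNReal.toReal_nonneg
  have hM' : ∀ᵐ x ∂μ, W x ≤ M' := by
    have hmem : MemLp (fun x => max (W x) 0) ∞ μ := by
      refine memLp_top_of_bound (hW.max measurable_const).aestronglyMeasurable (C + |m|)
        (Eventually.of_forall fun x => ?_)
      rw [Real.norm_of_nonneg (le_max_right _ _)]
      exact max_le ((le_abs_self _).trans (hWC x)) ((abs_nonneg _).trans (hWC x))
    have h1 := ae_le_eLpNormEssSup (f := fun x => max (W x) 0) (μ := μ)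
    rw [← eLpNorm_exponent_top] at h1
    filter_upwards [h1] with x hx
    have h2 := ENNReal.toReal_mono hmem.eLpNorm_ne_top hx
    rw [toReal_enorm, Real.norm_of_nonneg (le_max_right _ _)] at h2
    exact (le_max_left _ _).trans h2
  set M : ℝ := α * M' with hMdef
  have hM0 : 0 ≤ M := by positivity
  have hMu : 0 < M + u := by linarith
  set c : ℝ := 1 / (M + u) with hcdef
  have hc : 0 < c := by positivity
  have hcM : 1 - c * M = u * c := by
    rw [hcdef]
    field_simp
    ring
  have hcM1 : c * (α * M') < 1 := by
    have : 0 < u * c := by positivity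
    linarith
  have hk := kappa_const_mul_le hα hpoinc hW hWC hW0 hM' hc hcM1
  rw [← hMdef, hcM, hW2] at hk
  have hfun : (fun x => s * c * (f x - m)) = fun x => c * W x := by
    ext x
    simp only [hWdef]
    ring
  have hηr : (η : EReal) = ((η.toReal : ℝ) : EReal) := by
    rw [← EReal.coe_toReal (x := (η : EReal)) (by simpa using hη) (by simp),
      EReal.toReal_coe_ennreal]
  calc Xi s (fun c => kappa p μ fun x => c * (f x - m)) η
      ≤ (kappa p μ (fun x => s * c * (f x - m)) + (η : EReal)) / (c : EReal) := iInf₂_le c hc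
    _ ≤ (((α * c ^ 2 * Var[f; μ] / (u * c) : ℝ) : EReal) + ((η.toReal : ℝ) : EReal))
          / (c : EReal) := by
        rw [hfun, hηr]
        exact EReal.monotone_div_right_of_nonneg (EReal.coe_nonneg.2 hc.le) (add_le_add_left hk _)
    _ = _ := by
        rw [← EReal.coe_add, ← EReal.coe_div, hM, EReal.coe_eq_coe_iff]
        have h1 : (α * c ^ 2 * Var[f; μ] / (u * c) + η.toReal) / c
            = α * Var[f; μ] / u + η.toReal * (1 / c) := by
          field_simp
        rw [h1, hcdef, one_div_one_div]

lemma Xi_le_sqrt_add {p : ℝ≥0 → Kernel 𝓧 𝓧} {α : ℝ} (hα : 0 < α)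
    (hpoinc : PoincareInequality p μ α) {f : 𝓧 → ℝ} (hf : Measurable f) {C : ℝ}
    (hC : ∀ x, |f x| ≤ C) {s : ℝ} (hs : s = 1 ∨ s = -1) {η : ℝ≥0∞} (hη : η ≠ ∞) :
    Xi s (fun c => kappa p μ fun x => c * (f x - ∫ y, f y ∂μ)) η
      ≤ ((√(2 * (2 * α * Var[f; μ]) * η.toReal) + bernsteinM s α μ f * η.toReal : ℝ) : EReal) := by
  set A : ℝ := α * Var[f; μ] with hA
  set e : ℝ := η.toReal with he
  have hA0 : 0 ≤ A := mul_nonneg hα.le (variance_nonneg _ _)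
  have he0 : 0 ≤ e := ENNReal.toReal_nonneg
  have hsqrt : √(2 * (2 * α * Var[f; μ]) * e) = 2 * (√A * √e) := by
    rw [← Real.sqrt_mul hA0, show 2 * (2 * α * Var[f; μ]) * e = 2 ^ 2 * (A * e) by rw [hA]; ring,
      Real.sqrt_mul (by norm_num), Real.sqrt_sq (by norm_num)]
  have hlim : Tendsto (fun ε : ℝ => ((2 * (√A * √e) + bernsteinM s α μ f * e
      + ε * (√A + √e) : ℝ) : EReal)) (𝓝[>] 0)
      (𝓝 ((2 * (√A * √e) + bernsteinM s α μ f * e + 0 * (√A + √e) : ℝ) : EReal)) := by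
    have : Continuous fun ε : ℝ => ((2 * (√A * √e) + bernsteinM s α μ f * e
      + ε * (√A + √e) : ℝ) : EReal) := continuous_coe_real_ereal.comp (by fun_prop)
    exact (this.tendsto 0).mono_left nhdsWithin_le_nhds
  rw [zero_mul, add_zero] at hlim
  rw [hsqrt]
  refine ge_of_tendsto hlim ?_
  filter_upwards [self_mem_nhdsWithin] with ε hε
  have hε' : (0 : ℝ) < ε := hε
  have hA1 : 0 < √A + ε := by positivity
  have he1 : 0 < √e + ε := by positivity
  -- The minimizer of `A / u + e u` is `√A / √e`; adding `ε` keeps it positive and finite.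
  refine (Xi_le hα hpoinc hf hC hs hη (div_pos hA1 he1)).trans ?_
  rw [EReal.coe_le_coe_iff]
  have h1 : A / ((√A + ε) / (√e + ε)) ≤ √A * (√e + ε) := by
    rw [div_div_eq_mul_div, div_le_iff₀ hA1]
    have : A = √A * √A := (Real.mul_self_sqrt hA0).symm
    have h0 : √A * √A ≤ √A * (√A + ε) := by gcongr; linarith
    calc A * (√e + ε) = √A * √A * (√e + ε) := by rw [← this]
      _ ≤ √A * (√A + ε) * (√e + ε) := by gcongr
      _ = _ := by ring
  have h2 : e * ((√A + ε) / (√e + ε)) ≤ √e * (√A + ε) := by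
    rw [← mul_div_assoc, div_le_iff₀ he1]
    have : e = √e * √e := (Real.mul_self_sqrt he0).symm
    have h0 : √e * √e ≤ √e * (√e + ε) := by gcongr; linarith
    calc e * (√A + ε) = √e * √e * (√A + ε) := by rw [← this]
      _ ≤ √e * (√e + ε) * (√A + ε) := by gcongr
      _ = _ := by ring
  rw [mul_add]
  linarith

end Bernstein

end

end MarkovUQ

theorem mainTheorem3 {Ω 𝓧 : Type*} [mΩ : MeasurableSpace Ω]
    [TopologicalSpace 𝓧] [PolishSpace 𝓧] [MeasurableSpace 𝓧] [BorelSpace 𝓧]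
    (ℱ : Filtration ℝ≥0 mΩ) (X : ℝ≥0 → Ω → 𝓧) (p : ℝ≥0 → Kernel 𝓧 𝓧)
    (P Q : 𝓧 → Measure Ω)
    (hP : MarkovUQ.IsMarkovFamily ℱ X p P)
    (hQ : MarkovUQ.IsInitialFamily X Q)
    (μs : Measure 𝓧) [IsProbabilityMeasure μs] (hinv : ∀ t, Kernel.Invariant (p t) μs)
    (ν : Measure 𝓧) [IsProbabilityMeasure ν]
    (α : ℝ) (hα : 0 < α) (hpoinc : MarkovUQ.PoincareInequality p μs α)
    (f : 𝓧 → ℝ) (hf : Measurable f) (hfb : ∃ C : ℝ, ∀ x, |f x| ≤ C)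
    (T : ℝ≥0) (hT : 0 < T)
    (η : ℝ≥0∞)
    (hη : η = MarkovUQ.relEntropyUpTo ℱ T (MarkovUQ.mixture ν Q hQ.univMeas)
      (MarkovUQ.mixture μs P hP.univMeas) / (T : ℝ≥0∞))
    (s : ℝ) (hs : s = 1 ∨ s = -1) :
    ((s * MarkovUQ.bias X (MarkovUQ.mixture ν Q hQ.univMeas) μs f T : ℝ) : EReal) ≤
        MarkovUQ.Xi s (fun c => MarkovUQ.kappa p μs (fun x => c * (f x - ∫ y, f y ∂μs))) η ∧
      (η ≠ ∞ →
        MarkovUQ.Xi s (fun c => MarkovUQ.kappa p μs (fun x => c * (f x - ∫ y, f y ∂μs))) η ≤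
          ((√(2 * (2 * α * Var[f; μs]) * η.toReal)
            + MarkovUQ.bernsteinM s α μs f * η.toReal : ℝ) : EReal)) := by
  obtain ⟨C, hC⟩ := hfb
  have hX := hP.isStationaryMarkov μs hinv
  have := MarkovUQ.isProbabilityMeasure_mixture (μ := ν) hQ.univMeas hQ.isProb
  refine ⟨?_, fun hη' => MarkovUQ.Xi_le_sqrt_add hα hpoinc hf hC hs hη'⟩
  rw [hη]
  exact hX.bias_le_Xi hf hC hT s
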